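/- Let $k$ be an algebraically closed field of characteristic $p$, let $H$ be a finite dimensional semisimple Hopf algebra over $k$ with comultiplication $\Delta(a)=a_{(1)}\otimes a_{(2)}$, counit $\varepsilon$ and antipode $S$, and assume that either $p>\dim_k(H)^{1/2}$ or $p=0$. For $n\in\mathbb{Z}$ let $P_n:H\to H$ be the $n$-th Sweedler power map: $P_n(a)=a_{(1)}\cdots a_{(n)}$ for $n\ge 1$, $P_0(a)=\varepsilon(a)1$, and $P_n(a)=S(a_{(1)})\cdots S(a_{(-n)})$ for $n\le -1$. For a nonzero integral $\Lambda$ of $H$ (that is, $h\Lambda=\varepsilon(h)\Lambda$ for all $h\in H$) put $\mathbf{u}=S(\Lambda_{(2)})\Lambda_{(1)}$. For a finite dimensional $H$-module $V$ with character $\chi_V$, the $n$-th Frobenius–Schur indicator of $V$ is $\nu_n(V)=\chi_V(\mathbf{u}^{-1}P_n(\Lambda))$. A normalized twist for $H$ is an invertible element $J=J^{(1)}\otimes J^{(2)}\in H\otimes H$ with $(\varepsilon\otimes \mathrm{id})(J)=(\mathrm{id}\otimes\varepsilon)(J)=1$ and $(\Delta\otimes \mathrm{id})(J)(J\otimes 1)=(\mathrm{id}\otimes\Delta)(J)(1\otimes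 J)$. The twisted Hopf algebra $H^J$ has the same algebra structure and counit as $H$, comultiplication $\Delta^J(a)=J^{-1}\Delta(a)J$ and antipode $S^J(a)=Q_J^{-1}S(a)Q_J$, where $Q_J=S(J^{(1)})J^{(2)}$. Write $V^J$ for $V$ regarded as an $H^J$-module. Then for every normalized twist $J$ for $H$, every finite dimensional $H$-module $V$ and every $n\in\mathbb{Z}$, $$\nu_n(V^J)=\nu_n(V).$$ In detail: $H$ and $H^J$ have nonzero integrals; for every nonzero integral $\Lambda$ of $H$ and every nonzero integral $\Lambda'$ of $H^J$, the elements $\mathbf{u}$ of $H$ and $\mathbf{u}^J$ of $H^J$ formed from them are invertible, and the indicators computed with $\Lambda'$ in $H^J$ and with $\Lambda$ in $H$ are equal. -/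

import Mathlib

open scoped TensorProduct

noncomputable section

namespace HopfFS

section Basic

variable (k : Type*) {H : Type*} [Field k] [Ring H] [HopfAlgebra k H]

/-- `Λ` is a left integral of `H`: `h Λ = ε(h) Λ` for all `h`. -/
def IsLeftIntegral (Λ : H) : Prop :=
  ∀ h : H, h * Λ = (Coalgebra.counit (R := k) h) • Λ

/-- The element `u = S(Λ₍₂₎) Λ₍₁₎` attached to `Λ`. -/
def uElement (Λ : H) : H :=
  LinearMap.mul' k H
    (TensorProduct.map (HopfAlgebra.antipode k) LinearMap.id
      (TensorProduct.comm k H H (Coalgebra.comul (R := k) Λ)))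

/-- The Sweedler power map `P_n`. The powers are taken with respect to the convolution product
`f * g = m ∘ (f ⊗ g) ∘ Δ` (unit `a ↦ ε(a) 1`) on linear endomorphisms of `H`; so `P_n` is
`a ↦ a₍₁₎ ⋯ a₍ₙ₎` for `n ≥ 1`, `a ↦ ε(a) 1` for `n = 0` and `a ↦ S(a₍₁₎) ⋯ S(a₍₋ₙ₎)` for
`n ≤ -1`. -/
def sweedlerPower : ℤ → (H →ₗ[k] H)
  | Int.ofNat n => (WithConv.toConv (LinearMap.id : H →ₗ[k] H) ^ n).ofConv
  | Int.negSucc n => (WithConv.toConv (HopfAlgebra.antipode k : H →ₗ[k] H) ^ (n + 1)).ofConv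

/-- The `n`-th Frobenius-Schur indicator `ν_n(V) = χ_V(u⁻¹ P_n(Λ))` of a representation
`ρ : H → End_k(V)`, computed with the integral `Λ`. (`Ring.inverse` is the inverse of a unit.) -/
def fsIndicator (Λ : H) {V : Type*} [AddCommGroup V] [Module k V]
    (ρ : H →ₐ[k] Module.End k V) (n : ℤ) : k :=
  LinearMap.trace k V (ρ (Ring.inverse (uElement k Λ) * sweedlerPower k n Λ))

end Basic

/-- A normalized twist of `H`: an invertible `J ∈ H ⊗ H` with
`(ε ⊗ id)(J) = (id ⊗ ε)(J) = 1` and `(Δ ⊗ id)(J)(J ⊗ 1) = (id ⊗ Δ)(J)(1 ⊗ J)`. -/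
structure Twist (k : Type*) (H : Type*) [Field k] [Ring H] [HopfAlgebra k H] where
  /-- the invertible element `J` -/
  J : (H ⊗[k] H)ˣ
  counit_left : Algebra.TensorProduct.lid k H
    (Algebra.TensorProduct.map (Bialgebra.counitAlgHom k H) (AlgHom.id k H) J) = 1
  counit_right : Algebra.TensorProduct.rid k k H
    (Algebra.TensorProduct.map (AlgHom.id k H) (Bialgebra.counitAlgHom k H) J) = 1
  cocycle : Algebra.TensorProduct.assoc k k k H H H
      (Algebra.TensorProduct.map (Bialgebra.comulAlgHom k H) (AlgHom.id k H) J *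
        ((J : H ⊗[k] H) ⊗ₜ[k] (1 : H))) =
    Algebra.TensorProduct.map (AlgHom.id k H) (Bialgebra.comulAlgHom k H) J *
      ((1 : H) ⊗ₜ[k] (J : H ⊗[k] H))

namespace Twist

variable {k : Type*} {H : Type*} [Field k] [Ring H] [HopfAlgebra k H] (T : Twist k H)

/-- The linear map `a ⊗ b ↦ S(a) b`. -/
def leftContr (k : Type*) (H : Type*) [Field k] [Ring H] [HopfAlgebra k H] : H ⊗[k] H →ₗ[k] H :=
  LinearMap.mul' k H ∘ₗ TensorProduct.map (HopfAlgebra.antipode k) LinearMap.id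

/-- The linear map `a ⊗ b ↦ a S(b)`. -/
def rightContr (k : Type*) (H : Type*) [Field k] [Ring H] [HopfAlgebra k H] : H ⊗[k] H →ₗ[k] H :=
  LinearMap.mul' k H ∘ₗ TensorProduct.map LinearMap.id (HopfAlgebra.antipode k)

@[simp] theorem leftContr_tmul (a b : H) :
    leftContr k H (a ⊗ₜ b) = HopfAlgebra.antipode k a * b := rfl

@[simp] theorem rightContr_tmul (a b : H) :
    rightContr k H (a ⊗ₜ b) = a * HopfAlgebra.antipode k b := rfl

/-- `Q_J = S(J⁽¹⁾) J⁽²⁾`. -/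
def q : H := leftContr k H T.J

/-- `Q_J⁻¹ = J⁻⁽¹⁾ S(J⁻⁽²⁾)`. -/
def qInv : H := rightContr k H (T.J⁻¹ : (H ⊗[k] H)ˣ)

/-- The twisted comultiplication `Δ^J(a) = J⁻¹ Δ(a) J`. -/
def comulAlgHom : H →ₐ[k] H ⊗[k] H :=
  AlgHom.ofLinearMap
    (LinearMap.mulLeft k ((T.J⁻¹ : (H ⊗[k] H)ˣ) : H ⊗[k] H) ∘ₗ
      LinearMap.mulRight k (T.J : H ⊗[k] H) ∘ₗ (Coalgebra.comul : H →ₗ[k] H ⊗[k] H))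
    (by simp)
    (fun a b => by simp [mul_assoc])

theorem comulAlgHom_apply (a : H) :
    T.comulAlgHom a = ((T.J⁻¹ : (H ⊗[k] H)ˣ) : H ⊗[k] H) *
      (Coalgebra.comul (R := k) a * (T.J : H ⊗[k] H)) := rfl

/-- The twisted antipode `S^J(a) = Q_J⁻¹ S(a) Q_J`. -/
def antipode : H →ₗ[k] H :=
  LinearMap.mulLeft k T.qInv ∘ₗ LinearMap.mulRight k T.q ∘ₗ HopfAlgebra.antipode k

theorem antipode_apply (a : H) :
    T.antipode a = T.qInv * (HopfAlgebra.antipode k a * T.q) := rfl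

/-- `a ⊗ b ⊗ c ↦ a S(b) c`. -/
def triple (k : Type*) (H : Type*) [Field k] [Ring H] [HopfAlgebra k H] :
    H ⊗[k] (H ⊗[k] H) →ₗ[k] H :=
  LinearMap.mul' k H ∘ₗ LinearMap.lTensor H (leftContr k H)

@[simp] theorem triple_tmul (a b c : H) :
    triple k H (a ⊗ₜ (b ⊗ₜ c)) = a * (HopfAlgebra.antipode k b * c) := rfl

/-- `b a₍₁₎ S(c a₍₂₎) = ε(a) b S(c)` -/
theorem rightContr_mul_comul (X : H ⊗[k] H) (a : H) :
    rightContr k H (X * Coalgebra.comul (R := k) a) =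
      Coalgebra.counit (R := k) a • rightContr k H X := by
  induction X with
  | zero => simp
  | add x y hx hy => simp [add_mul, hx, hy]
  | tmul x y =>
    have h : ∀ D : H ⊗[k] H, rightContr k H ((x ⊗ₜ y) * D) =
        x * (rightContr k H D * HopfAlgebra.antipode k y) := by
      intro D
      induction D with
      | zero => simp
      | add a b ha hb => simp [mul_add, add_mul, ha, hb]
      | tmul a b => simp [HopfAlgebra.antipode_mul_antidistrib, mul_assoc]
    have h2 : rightContr k H (Coalgebra.comul (R := k) a) =
        algebraMap k H (Coalgebra.counit (R := k) a) :=
      HopfAlgebra.mul_antipode_lTensor_comul_apply a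
    rw [h, h2, Algebra.algebraMap_eq_smul_one]
    simp

/-- `S(a₍₁₎ b) a₍₂₎ c = ε(a) S(b) c` -/
theorem leftContr_comul_mul (X : H ⊗[k] H) (a : H) :
    leftContr k H (Coalgebra.comul (R := k) a * X) =
      Coalgebra.counit (R := k) a • leftContr k H X := by
  induction X with
  | zero => simp
  | add x y hx hy => simp [mul_add, hx, hy]
  | tmul x y =>
    have h : ∀ D : H ⊗[k] H, leftContr k H (D * (x ⊗ₜ y)) =
        HopfAlgebra.antipode k x * (leftContr k H D * y) := by
      intro D
      induction D with
      | zero => simp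
      | add a b ha hb => simp [mul_add, add_mul, ha, hb]
      | tmul a b => simp [HopfAlgebra.antipode_mul_antidistrib, mul_assoc]
    have h2 : leftContr k H (Coalgebra.comul (R := k) a) =
        algebraMap k H (Coalgebra.counit (R := k) a) :=
      HopfAlgebra.mul_antipode_rTensor_comul_apply a
    rw [h, h2, Algebra.algebraMap_eq_smul_one]
    simp

theorem triple_one_tmul (X Y : H ⊗[k] H) :
    triple k H (((1 : H) ⊗ₜ[k] Y) * Algebra.TensorProduct.assoc k k k H H H (X ⊗ₜ[k] (1 : H))) =
      rightContr k H X * leftContr k H Y := by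
  induction X with
  | zero => simp
  | add x y hx hy => simp [TensorProduct.add_tmul, mul_add, add_mul, hx, hy]
  | tmul x y =>
    induction Y with
    | zero => simp
    | add x y hx hy => simp only [TensorProduct.tmul_add, map_add, mul_add, add_mul, hx, hy]
    | tmul a b => simp [HopfAlgebra.antipode_mul_antidistrib, mul_assoc]

theorem triple_comul (X Y : H ⊗[k] H) :
    triple k H (Algebra.TensorProduct.map (AlgHom.id k H) (Bialgebra.comulAlgHom k H) X *
      Algebra.TensorProduct.assoc k k k H H H
        (Algebra.TensorProduct.map (Bialgebra.comulAlgHom k H) (AlgHom.id k H) Y)) =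
      Algebra.TensorProduct.rid k k H
        (Algebra.TensorProduct.map (AlgHom.id k H) (Bialgebra.counitAlgHom k H) X) *
      Algebra.TensorProduct.lid k H
        (Algebra.TensorProduct.map (Bialgebra.counitAlgHom k H) (AlgHom.id k H) Y) := by
  induction X with
  | zero => simp
  | add x y hx hy => simp [add_mul, hx, hy]
  | tmul x y =>
    induction Y with
    | zero => simp
    | add x y hx hy => simp only [map_add, mul_add, hx, hy]
    | tmul a b =>
      have h : ∀ D : H ⊗[k] H, triple k H ((x ⊗ₜ[k] Coalgebra.comul (R := k) y) *
          Algebra.TensorProduct.assoc k k k H H H (D ⊗ₜ[k] b)) =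
          Coalgebra.counit (R := k) y • (x * rightContr k H D * b) := by
        intro D
        induction D with
        | zero => simp
        | add a b ha hb => simp [TensorProduct.add_tmul, mul_add, add_mul, ha, hb]
        | tmul c d =>
          have h2 := leftContr_comul_mul (k := k) (d ⊗ₜ[k] b) y
          rw [Algebra.TensorProduct.assoc_tmul, Algebra.TensorProduct.tmul_mul_tmul]
          change (x * c) * leftContr k H _ = _
          rw [h2]
          simp [mul_assoc]
      have h3 : rightContr k H (Coalgebra.comul (R := k) a) =
          algebraMap k H (Coalgebra.counit (R := k) a) :=
        HopfAlgebra.mul_antipode_lTensor_comul_apply a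
      simp only [Algebra.TensorProduct.map_tmul, AlgHom.id_apply,
        Bialgebra.comulAlgHom_apply, Bialgebra.counitAlgHom_apply, h, h3,
        Algebra.algebraMap_eq_smul_one, Algebra.TensorProduct.rid_tmul,
        Algebra.TensorProduct.lid_tmul, mul_smul_comm, smul_mul_assoc, mul_one]
      rw [smul_comm]

theorem qInv_mul_q : T.qInv * T.q = 1 := by
  set A2 := Algebra.TensorProduct.map (AlgHom.id k H) (Bialgebra.comulAlgHom k H)
  set A1 := Algebra.TensorProduct.map (Bialgebra.comulAlgHom k H) (AlgHom.id k H)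
  set as := Algebra.TensorProduct.assoc k k k H H H
  have e : A2 (T.J⁻¹ : (H ⊗[k] H)ˣ) * as (A1 T.J) =
      ((1 : H) ⊗ₜ[k] (T.J : H ⊗[k] H)) *
        as (((T.J⁻¹ : (H ⊗[k] H)ˣ) : H ⊗[k] H) ⊗ₜ[k] (1 : H)) := by
    have c : as (A1 T.J) * as ((T.J : H ⊗[k] H) ⊗ₜ[k] (1 : H)) =
        A2 T.J * ((1 : H) ⊗ₜ[k] (T.J : H ⊗[k] H)) := by
      rw [← map_mul]; exact T.cocycle
    have u1 : A2 (T.J⁻¹ : (H ⊗[k] H)ˣ) * A2 T.J = 1 := by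
      rw [← map_mul, Units.inv_mul, map_one]
    have u2 : as ((T.J : H ⊗[k] H) ⊗ₜ[k] (1 : H)) *
        as (((T.J⁻¹ : (H ⊗[k] H)ˣ) : H ⊗[k] H) ⊗ₜ[k] (1 : H)) = 1 := by
      rw [← map_mul, Algebra.TensorProduct.tmul_mul_tmul, Units.mul_inv, mul_one,
        ← Algebra.TensorProduct.one_def, map_one]
    calc _ = A2 (T.J⁻¹ : (H ⊗[k] H)ˣ) * (as (A1 T.J) *
          (as ((T.J : H ⊗[k] H) ⊗ₜ[k] (1 : H)) *
        as (((T.J⁻¹ : (H ⊗[k] H)ˣ) : H ⊗[k] H) ⊗ₜ[k] (1 : H)))) := by rw [u2, mul_one]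
      _ = _ := by rw [← mul_assoc (as (A1 T.J)), c, mul_assoc (A2 T.J), ← mul_assoc, u1, one_mul]
  have h := congrArg (triple k H) e
  rw [triple_one_tmul, triple_comul, T.counit_left, mul_one] at h
  have r : Algebra.TensorProduct.rid k k H
      (Algebra.TensorProduct.map (AlgHom.id k H) (Bialgebra.counitAlgHom k H)
        ((T.J⁻¹ : (H ⊗[k] H)ˣ) : H ⊗[k] H)) = 1 := by
    have := T.counit_right
    set f := ((Algebra.TensorProduct.rid k k H).toAlgHom.comp
      (Algebra.TensorProduct.map (AlgHom.id k H) (Bialgebra.counitAlgHom k H)))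
    have h1 : f T.J = 1 := this
    have h2 : f (T.J⁻¹ : (H ⊗[k] H)ˣ) * f T.J = 1 := by
      rw [← map_mul, Units.inv_mul, map_one]
    rw [h1, mul_one] at h2
    exact h2
  rw [r] at h
  exact h.symm

theorem map_comulAlgHom_id (X : H ⊗[k] H) :
    Algebra.TensorProduct.map T.comulAlgHom (AlgHom.id k H) X =
      (((T.J⁻¹ : (H ⊗[k] H)ˣ) : H ⊗[k] H) ⊗ₜ[k] (1 : H)) *
      (Algebra.TensorProduct.map (Bialgebra.comulAlgHom k H) (AlgHom.id k H) X *
        ((T.J : H ⊗[k] H) ⊗ₜ[k] (1 : H))) := by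
  induction X with
  | zero => simp
  | add x y hx hy => simp only [map_add, hx, hy, add_mul, mul_add]
  | tmul x y => simp [comulAlgHom_apply]

theorem map_id_comulAlgHom (X : H ⊗[k] H) :
    Algebra.TensorProduct.map (AlgHom.id k H) T.comulAlgHom X =
      ((1 : H) ⊗ₜ[k] ((T.J⁻¹ : (H ⊗[k] H)ˣ) : H ⊗[k] H)) *
      (Algebra.TensorProduct.map (AlgHom.id k H) (Bialgebra.comulAlgHom k H) X *
        ((1 : H) ⊗ₜ[k] (T.J : H ⊗[k] H))) := by
  induction X with
  | zero => simp
  | add x y hx hy => simp only [map_add, hx, hy, add_mul, mul_add]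
  | tmul x y => simp [comulAlgHom_apply]

theorem coassoc : (Algebra.TensorProduct.assoc k k k H H H).toAlgHom.comp
      ((Algebra.TensorProduct.map T.comulAlgHom (.id k H)).comp T.comulAlgHom) =
    (Algebra.TensorProduct.map (.id k H) T.comulAlgHom).comp T.comulAlgHom := by
  ext a
  set A2 := Algebra.TensorProduct.map (AlgHom.id k H) (Bialgebra.comulAlgHom k H) with hA2
  set A1 := Algebra.TensorProduct.map (Bialgebra.comulAlgHom k H) (AlgHom.id k H) with hA1
  set as := Algebra.TensorProduct.assoc k k k H H H with has
  set J : H ⊗[k] H := (T.J : H ⊗[k] H)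
  set J' : H ⊗[k] H := ((T.J⁻¹ : (H ⊗[k] H)ˣ) : H ⊗[k] H)
  change as (Algebra.TensorProduct.map T.comulAlgHom (.id k H) (T.comulAlgHom a)) =
    Algebra.TensorProduct.map (.id k H) T.comulAlgHom (T.comulAlgHom a)
  have JJ : J * J' = 1 := Units.mul_inv _
  have JJ' : J' * J = 1 := Units.inv_mul _
  have c : as (A1 J) * as (J ⊗ₜ[k] (1 : H)) = A2 J * ((1 : H) ⊗ₜ[k] J) := by
    rw [← map_mul]; exact T.cocycle
  have c' : as (J' ⊗ₜ[k] (1 : H)) * as (A1 J') = ((1 : H) ⊗ₜ[k] J') * A2 J' := by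
    refine left_inv_eq_right_inv (a := as (A1 J) * as (J ⊗ₜ[k] (1 : H))) ?_ ?_
    · simp only [← map_mul]
      rw [mul_assoc, ← mul_assoc (A1 J'), ← map_mul, JJ', map_one, one_mul,
        Algebra.TensorProduct.tmul_mul_tmul, JJ', mul_one, ← Algebra.TensorProduct.one_def, map_one]
    · rw [c, mul_assoc, ← mul_assoc ((1 : H) ⊗ₜ[k] J), Algebra.TensorProduct.tmul_mul_tmul, JJ,
        mul_one, ← Algebra.TensorProduct.one_def, one_mul, ← map_mul, JJ, map_one]
  have ca : as (A1 (Coalgebra.comul (R := k) a)) = A2 (Coalgebra.comul (R := k) a) :=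
    Coalgebra.coassoc_apply a
  rw [map_comulAlgHom_id, map_id_comulAlgHom, comulAlgHom_apply]
  change as ((J' ⊗ₜ[k] (1 : H)) * (A1 (J' * (Coalgebra.comul (R := k) a * J)) * (J ⊗ₜ[k] (1 : H)))) =
    ((1 : H) ⊗ₜ[k] J') * (A2 (J' * (Coalgebra.comul (R := k) a * J)) * ((1 : H) ⊗ₜ[k] J))
  simp only [map_mul]
  calc _ = (as (J' ⊗ₜ[k] (1 : H)) * as (A1 J')) * (as (A1 (Coalgebra.comul (R := k) a)) *
        (as (A1 J) * as (J ⊗ₜ[k] (1 : H)))) := by simp only [mul_assoc]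
    _ = _ := by rw [c, c', ca]; simp only [mul_assoc]

theorem rTensor_counit :
    (Algebra.TensorProduct.map (Bialgebra.counitAlgHom k H) (.id k H)).comp T.comulAlgHom =
      (Algebra.TensorProduct.lid k H).symm := by
  ext a
  apply (Algebra.TensorProduct.lid k H).injective
  set f := ((Algebra.TensorProduct.lid k H).toAlgHom.comp
    (Algebra.TensorProduct.map (Bialgebra.counitAlgHom k H) (AlgHom.id k H))) with hf
  have h1 : f T.J = 1 := T.counit_left
  have h2 : f (T.J⁻¹ : (H ⊗[k] H)ˣ) = 1 := by
    have : f (T.J⁻¹ : (H ⊗[k] H)ˣ) * f T.J = 1 := by rw [← map_mul, Units.inv_mul, map_one]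
    rwa [h1, mul_one] at this
  have h3 : f (Coalgebra.comul (R := k) a) = a := by
    have := Coalgebra.rTensor_counit_comul (R := k) a
    change Algebra.TensorProduct.lid k H
      ((Coalgebra.counit (R := k)).rTensor H (Coalgebra.comul (R := k) a)) = a
    rw [this]; simp
  change f (T.comulAlgHom a) =
    Algebra.TensorProduct.lid k H ((Algebra.TensorProduct.lid k H).symm a)
  rw [comulAlgHom_apply, map_mul, map_mul, h1, h2, h3]
  simp

theorem lTensor_counit :
    (Algebra.TensorProduct.map (.id k H) (Bialgebra.counitAlgHom k H)).comp T.comulAlgHom =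
      (Algebra.TensorProduct.rid k k H).symm := by
  ext a
  apply (Algebra.TensorProduct.rid k k H).injective
  set f := ((Algebra.TensorProduct.rid k k H).toAlgHom.comp
    (Algebra.TensorProduct.map (AlgHom.id k H) (Bialgebra.counitAlgHom k H))) with hf
  have h1 : f T.J = 1 := T.counit_right
  have h2 : f (T.J⁻¹ : (H ⊗[k] H)ˣ) = 1 := by
    have : f (T.J⁻¹ : (H ⊗[k] H)ˣ) * f T.J = 1 := by rw [← map_mul, Units.inv_mul, map_one]
    rwa [h1, mul_one] at this
  have h3 : f (Coalgebra.comul (R := k) a) = a := by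
    have := Coalgebra.lTensor_counit_comul (R := k) a
    change Algebra.TensorProduct.rid k k H
      ((Coalgebra.counit (R := k)).lTensor H (Coalgebra.comul (R := k) a)) = a
    rw [this]; simp
  change f (T.comulAlgHom a) =
    Algebra.TensorProduct.rid k k H ((Algebra.TensorProduct.rid k k H).symm a)
  rw [comulAlgHom_apply, map_mul, map_mul, h1, h2, h3]
  simp

theorem leftContr_J_mul (X Y : H ⊗[k] H) :
    LinearMap.mul' k H (T.antipode.rTensor H (X * Y)) =
      T.qInv * leftContr k H ((T.J : H ⊗[k] H) * (X * Y)) := by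
  generalize X * Y = D
  induction D with
  | zero => simp
  | add x y hx hy => simp [mul_add, hx, hy]
  | tmul x y =>
    have h : ∀ Z : H ⊗[k] H, HopfAlgebra.antipode k x * (leftContr k H Z * y) =
        leftContr k H (Z * (x ⊗ₜ y)) := by
      intro D
      induction D with
      | zero => simp
      | add a b ha hb => simp [mul_add, add_mul, ha, hb]
      | tmul a b => simp [HopfAlgebra.antipode_mul_antidistrib, mul_assoc]
    rw [← h]
    simp [antipode_apply, q, mul_assoc]

theorem rightContr_mul_J (D : H ⊗[k] H) :
    LinearMap.mul' k H (T.antipode.lTensor H D) =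
      rightContr k H (D * ((T.J⁻¹ : (H ⊗[k] H)ˣ) : H ⊗[k] H)) * T.q := by
  induction D with
  | zero => simp
  | add x y hx hy => simp [add_mul, hx, hy]
  | tmul x y =>
    have h : ∀ Z : H ⊗[k] H, x * (rightContr k H Z * HopfAlgebra.antipode k y) =
        rightContr k H ((x ⊗ₜ y) * Z) := by
      intro D
      induction D with
      | zero => simp
      | add a b ha hb => simp [mul_add, add_mul, ha, hb]
      | tmul a b => simp [HopfAlgebra.antipode_mul_antidistrib, mul_assoc]
    rw [← h]
    simp [antipode_apply, qInv, mul_assoc]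

/-- The bialgebra structure `(H, m, 1, Δ^J, ε)`. -/
abbrev bialgebra : Bialgebra k H :=
  Bialgebra.ofAlgHom T.comulAlgHom (Bialgebra.counitAlgHom k H)
    T.coassoc T.rTensor_counit T.lTensor_counit

/-- The Hopf algebra structure `(H, m, 1, Δ^J, ε, S^J)`. -/
abbrev hopfAlgebra : HopfAlgebra k H :=
  { T.bialgebra with
    antipode := T.antipode
    mul_antipode_rTensor_comul := by
      ext a
      change LinearMap.mul' k H (T.antipode.rTensor H (T.comulAlgHom a)) =
        algebraMap k H (Coalgebra.counit (R := k) a)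
      rw [comulAlgHom_apply, leftContr_J_mul, ← mul_assoc, Units.mul_inv, one_mul,
        leftContr_comul_mul, mul_smul_comm]
      change _ • (T.qInv * T.q) = _
      rw [qInv_mul_q, Algebra.algebraMap_eq_smul_one]
    mul_antipode_lTensor_comul := by
      ext a
      change LinearMap.mul' k H (T.antipode.lTensor H (T.comulAlgHom a)) =
        algebraMap k H (Coalgebra.counit (R := k) a)
      rw [comulAlgHom_apply, rightContr_mul_J, mul_assoc, mul_assoc, Units.mul_inv, mul_one,
        rightContr_mul_comul, smul_mul_assoc]
      change _ • (T.qInv * T.q) = _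
      rw [qInv_mul_q, Algebra.algebraMap_eq_smul_one] }

/-- The Hopf algebra `H^J`, a copy of the algebra `H`. -/
@[nolint unusedArguments]
def Twisted (_T : Twist k H) : Type _ := H

instance : Ring T.Twisted := inferInstanceAs (Ring H)

/-- `H^J` carries the twisted comultiplication `Δ^J`, the counit `ε` and the antipode `S^J`. -/
instance : HopfAlgebra k T.Twisted := T.hopfAlgebra

/-- The identity map `H^J → H`, an isomorphism of algebras. -/
def toOriginal : T.Twisted ≃ₐ[k] H := (AlgEquiv.refl : H ≃ₐ[k] H)

theorem counit_twisted (a : T.Twisted) :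
    Coalgebra.counit (R := k) a = Coalgebra.counit (R := k) (T.toOriginal a) := rfl

theorem comul_twisted (a : T.Twisted) :
    TensorProduct.map T.toOriginal.toLinearMap T.toOriginal.toLinearMap
      (Coalgebra.comul (R := k) a) =
    ((T.J⁻¹ : (H ⊗[k] H)ˣ) : H ⊗[k] H) *
      Coalgebra.comul (R := k) (T.toOriginal a) * (T.J : H ⊗[k] H) := by
  have : TensorProduct.map T.toOriginal.toLinearMap T.toOriginal.toLinearMap =
      (LinearMap.id : H ⊗[k] H →ₗ[k] H ⊗[k] H) := TensorProduct.map_id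
  rw [mul_assoc]
  exact congrArg (fun f : H ⊗[k] H →ₗ[k] H ⊗[k] H => f (T.comulAlgHom a)) this

theorem antipode_twisted (a : T.Twisted) :
    T.toOriginal (HopfAlgebra.antipode k a) =
      T.qInv * HopfAlgebra.antipode k (T.toOriginal a) * T.q := by
  rw [mul_assoc]; rfl

/-- A representation of `H`, viewed as a representation of `H^J` on the same space. -/
def twistRep {V : Type*} [AddCommGroup V] [Module k V] (ρ : H →ₐ[k] Module.End k V) :
    T.Twisted →ₐ[k] Module.End k V :=
  ρ.comp T.toOriginal.toAlgHom

end Twist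

end HopfFS

end

/-!
Twisting invariance of Frobenius–Schur indicators. The indicator is a trace of an expression in
three ingredients, each of which is compared between `H` and `H^J`; since `H` and `H^J` share their
algebra structure and counit, they share their integrals, and these are two-sided and unique up to
a scalar because `H` is semisimple.

*Invertibility of `u`.* The tensor `Λ₍₁₎ ⊗ S(Λ₍₂₎) = x ⊗ y` satisfies `a x ⊗ y = x ⊗ y a` and
`x y = ε(Λ)`. On a matrix block of size `d` it is therefore `∑ E_{ij} ⊗ c E_{ji}` with
`tr c = ε(Λ) ≠ 0`, and `u = y x` acts as `d c`. By the assumption on the characteristic `d ≠ 0`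
in `k`. As `u h = S²(h) u`, the kernel of `u` is a submodule, so `u` is invertible on each block
(`isUnit_uElement`). Consequently `S²` is conjugation by `u`, and `S` is surjective.

*The trace.* The element `z = S(u) u` is central, and `u⁻¹ = z⁻¹ S(u)`. For central `w` one has
`χ(w S(u)) = χ(w S(Λ₍₁₎) S²(Λ₍₂₎)) = χ(w S(Λ₍₁₎ S(Λ₍₂₎))) = ε(Λ) χ(w)`. All Sweedler powers
`P_n(Λ)` are central, so the indicator equals `ε(Λ) χ(z⁻¹ P_n(Λ))` (`fsIndicator_eq`).

*Twisting.* The invariance of an integral lets it absorb the twist: `Δ^J(Λ) = (Q_J⁻¹ ⊗ 1) Δ(Λ)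
(1 ⊗ Q_J)`. This gives `u^J = Q_J⁻¹ S(Q_J) u`, hence `z^J = z`
(`Twist.toOriginal_antipode_uElement_mul_uElement`). For the Sweedler powers, the iterated
comultiplication of `H^J` is `j_n⁻¹ Δ⁽ⁿ⁾(·) j_n`, where the iterated twist can be written both as
`(id ⊗ Δ⁽ⁿ⁻¹⁾)(J) (1 ⊗ j_{n-1})` and as `(Δ⁽ⁿ⁻¹⁾ ⊗ id)(J) (j_{n-1} ⊗ 1)`. Using one form on the
left and the other on the right of `Δ⁽ⁿ⁾(Λ)`, the outer twists are absorbed as `Q_J⁻¹` and `Q_J`,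
while in the product of the tensor factors the remaining `j_{n-1}` and `j_{n-1}⁻¹` become adjacent
and cancel. So `P_n^J(Λ) = Q_J⁻¹ P_n(Λ) Q_J = P_n(Λ)` (`sweedlerPower_twisted`); negative powers
are treated in the same way through reversed products.
-/

noncomputable section

namespace HopfFS

/-! ### Integrals and their coproducts -/

section Integral

variable {k : Type*} {H : Type*} [Field k] [Ring H] [HopfAlgebra k H]

open Coalgebra HopfAlgebra TensorProduct

/-- `(b ⊗ 1) Δ(Λ)` and `(1 ⊗ a) Δ(Λ)` agree when `b = S(a)`: the antipode moves a left factor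
from the second leg of `Δ(Λ)` to the first. -/
theorem IsLeftIntegral.one_tmul_mul_comul {Λ : H} (hΛ : IsLeftIntegral k Λ) (h : H) :
    ((1 : H) ⊗ₜ[k] h) * comul (R := k) Λ =
      (antipode k h ⊗ₜ[k] (1 : H)) * comul (R := k) Λ := by
  -- `M (a ⊗ Y) = (S(a) ⊗ 1) Y Δ(Λ)` is evaluated at `h₍₁₎ ⊗ h₍₂₎ ⊗ h₍₃₎` in two ways
  let M : H ⊗[k] (H ⊗[k] H) →ₗ[k] H ⊗[k] H := LinearMap.mulRight k (comul (R := k) Λ) ∘ₗ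
    LinearMap.mul' k (H ⊗[k] H) ∘ₗ
      TensorProduct.map ((TensorProduct.mk k H H).flip 1 ∘ₗ antipode k) LinearMap.id
  have hM : ∀ a Y, M (a ⊗ₜ Y) = (antipode k a ⊗ₜ[k] (1 : H)) * Y * comul (R := k) Λ :=
    fun _ _ => rfl
  have h1 : ∀ Y : H ⊗[k] H, M (comul.lTensor H Y) =
      (antipode k (TensorProduct.rid k H (counit.lTensor H Y)) ⊗ₜ[k] (1 : H)) *
        comul (R := k) Λ := by
    intro Y
    induction Y with
    | zero => simp
    | add x y hx hy => simp only [map_add, hx, hy, add_tmul, add_mul]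
    | tmul a b =>
      rw [LinearMap.lTensor_tmul, hM, mul_assoc, ← Bialgebra.comul_mul, hΛ]
      simp [← smul_tmul']
  have h2 : ∀ (X : H ⊗[k] H) (c : H), M (TensorProduct.assoc k H H H (X ⊗ₜ c)) =
      (Twist.leftContr k H X ⊗ₜ[k] c) * comul (R := k) Λ := by
    intro X c
    induction X with
    | zero => simp
    | add x y hx hy => simp only [map_add, hx, hy, add_tmul, add_mul]
    | tmul a b => simp [hM]
  have h3 : ∀ Y : H ⊗[k] H, M (TensorProduct.assoc k H H H (comul.rTensor H Y)) =
      ((1 : H) ⊗ₜ[k] TensorProduct.lid k H (counit.rTensor H Y)) * comul (R := k) Λ := by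
    intro Y
    induction Y with
    | zero => simp
    | add x y hx hy => simp only [map_add, hx, hy, tmul_add, add_mul]
    | tmul a b =>
      have : Twist.leftContr k H (comul (R := k) a) = algebraMap k H (counit (R := k) a) :=
        mul_antipode_rTensor_comul_apply a
      rw [LinearMap.rTensor_tmul, h2, this, Algebra.algebraMap_eq_smul_one]
      simp [smul_tmul']
  have e := congrArg M (Coalgebra.coassoc_apply (R := k) h)
  rw [h1, h3, Coalgebra.rTensor_counit_comul, Coalgebra.lTensor_counit_comul] at e
  simpa using e

/-- `Λ` is a right integral of `H`: `Λ h = ε(h) Λ` for all `h`. -/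
def IsRightIntegral (k : Type*) {H : Type*} [Field k] [Ring H] [HopfAlgebra k H] (Λ : H) : Prop :=
  ∀ h : H, Λ * h = counit (R := k) h • Λ

/-- The antipode moves a right factor from the first leg of `Δ(Λ)` to the second. -/
theorem IsRightIntegral.comul_mul_tmul_one {Λ : H} (hΛ : IsRightIntegral k Λ) (h : H) :
    comul (R := k) Λ * (h ⊗ₜ[k] (1 : H)) =
      comul (R := k) Λ * ((1 : H) ⊗ₜ[k] antipode k h) := by
  -- `M (Y ⊗ a) = Δ(Λ) Y (1 ⊗ S(a))` is evaluated at `h₍₁₎ ⊗ h₍₂₎ ⊗ h₍₃₎` in two ways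
  let M : (H ⊗[k] H) ⊗[k] H →ₗ[k] H ⊗[k] H := LinearMap.mulLeft k (comul (R := k) Λ) ∘ₗ
    LinearMap.mul' k (H ⊗[k] H) ∘ₗ
      TensorProduct.map LinearMap.id (TensorProduct.mk k H H 1 ∘ₗ antipode k)
  have hM : ∀ Y a, M (Y ⊗ₜ a) = comul (R := k) Λ * (Y * ((1 : H) ⊗ₜ[k] antipode k a)) :=
    fun _ _ => rfl
  have h1 : ∀ Y : H ⊗[k] H, M (comul.rTensor H Y) =
      comul (R := k) Λ *
        ((1 : H) ⊗ₜ[k] antipode k (TensorProduct.lid k H (counit.rTensor H Y))) := by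
    intro Y
    induction Y with
    | zero => simp
    | add x y hx hy => simp only [map_add, hx, hy, tmul_add, mul_add]
    | tmul a b =>
      rw [LinearMap.rTensor_tmul, hM, ← mul_assoc, ← Bialgebra.comul_mul, hΛ]
      simp
  have h2 : ∀ (X : H ⊗[k] H) (c : H), M ((TensorProduct.assoc k H H H).symm (c ⊗ₜ X)) =
      comul (R := k) Λ * (c ⊗ₜ[k] Twist.rightContr k H X) := by
    intro X c
    induction X with
    | zero => simp
    | add x y hx hy => simp only [map_add, hx, hy, tmul_add, mul_add]
    | tmul a b => simp [hM]
  have h3 : ∀ Y : H ⊗[k] H, M ((TensorProduct.assoc k H H H).symm (comul.lTensor H Y)) =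
      comul (R := k) Λ * (TensorProduct.rid k H (counit.lTensor H Y) ⊗ₜ[k] (1 : H)) := by
    intro Y
    induction Y with
    | zero => simp
    | add x y hx hy => simp only [map_add, hx, hy, add_tmul, mul_add]
    | tmul a b =>
      have : Twist.rightContr k H (comul (R := k) b) = algebraMap k H (counit (R := k) b) :=
        mul_antipode_lTensor_comul_apply b
      rw [LinearMap.lTensor_tmul, h2, this, Algebra.algebraMap_eq_smul_one]
      simp [smul_tmul']
  have e := congrArg M (Coalgebra.coassoc_symm_apply (R := k) h)
  rw [h1, h3, Coalgebra.rTensor_counit_comul, Coalgebra.lTensor_counit_comul] at e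
  simpa using e

/-- The element `Λ₍₁₎ ⊗ S(Λ₍₂₎)`. -/
def casimir (k : Type*) {H : Type*} [Field k] [Ring H] [HopfAlgebra k H] (Λ : H) : H ⊗[k] H :=
  (antipode k).lTensor H (comul (R := k) Λ)

/-- For a left integral, `Λ₍₁₎ ⊗ S(Λ₍₂₎)` is a Casimir element: both sides equal
`a₍₁₎ Λ₍₁₎ ⊗ S(a₍₂₎ Λ₍₂₎) a₍₃₎`. Bijectivity of the antipode is not needed here. -/
theorem IsLeftIntegral.tmul_one_mul_casimir {Λ : H} (hΛ : IsLeftIntegral k Λ) (h : H) :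
    (h ⊗ₜ[k] (1 : H)) * casimir k Λ = casimir k Λ * ((1 : H) ⊗ₜ[k] h) := by
  let M : (H ⊗[k] H) ⊗[k] H →ₗ[k] H ⊗[k] H :=
    LinearMap.mul' k (H ⊗[k] H) ∘ₗ
      TensorProduct.map ((antipode k).lTensor H ∘ₗ LinearMap.mulRight k (comul (R := k) Λ))
        (TensorProduct.mk k H H 1)
  have hM : ∀ Y a, M (Y ⊗ₜ a) =
      (antipode k).lTensor H (Y * comul (R := k) Λ) * ((1 : H) ⊗ₜ[k] a) := fun _ _ => rfl
  have h1 : ∀ Y : H ⊗[k] H, M (comul.rTensor H Y) =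
      casimir k Λ * ((1 : H) ⊗ₜ[k] TensorProduct.lid k H (counit.rTensor H Y)) := by
    intro Y
    induction Y with
    | zero => simp
    | add x y hx hy => simp only [map_add, hx, hy, tmul_add, mul_add]
    | tmul a b =>
      rw [LinearMap.rTensor_tmul, hM, ← Bialgebra.comul_mul, hΛ]
      simp [casimir]
  have h0 : ∀ (a b : H) (D : H ⊗[k] H), (antipode k).lTensor H ((a ⊗ₜ[k] b) * D) =
      (a ⊗ₜ[k] (1 : H)) * (antipode k).lTensor H D * ((1 : H) ⊗ₜ[k] antipode k b) := by
    intro a b D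
    induction D with
    | zero => simp
    | add x y hx hy => simp only [map_add, hx, hy, add_mul, mul_add]
    | tmul c d => simp [antipode_mul_antidistrib]
  have h2 : ∀ (X : H ⊗[k] H) (c : H), M ((TensorProduct.assoc k H H H).symm (c ⊗ₜ X)) =
      (c ⊗ₜ[k] (1 : H)) * casimir k Λ * ((1 : H) ⊗ₜ[k] Twist.leftContr k H X) := by
    intro X c
    induction X with
    | zero => simp
    | add x y hx hy => simp only [map_add, hx, hy, tmul_add, mul_add]
    | tmul a b => simp [hM, h0, casimir, mul_assoc]
  have h3 : ∀ Y : H ⊗[k] H, M ((TensorProduct.assoc k H H H).symm (comul.lTensor H Y)) =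
      (TensorProduct.rid k H (counit.lTensor H Y) ⊗ₜ[k] (1 : H)) * casimir k Λ := by
    intro Y
    induction Y with
    | zero => simp
    | add x y hx hy => simp only [map_add, hx, hy, add_tmul, add_mul]
    | tmul a b =>
      have : Twist.leftContr k H (comul (R := k) b) = algebraMap k H (counit (R := k) b) :=
        mul_antipode_rTensor_comul_apply b
      rw [LinearMap.lTensor_tmul, h2, this, Algebra.algebraMap_eq_smul_one]
      simp [← smul_tmul', ← Algebra.TensorProduct.one_def]
  have e := congrArg M (Coalgebra.coassoc_symm_apply (R := k) h)
  rw [h1, h3, Coalgebra.rTensor_counit_comul, Coalgebra.lTensor_counit_comul] at e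
  simpa using e

theorem mul'_casimir (Λ : H) :
    LinearMap.mul' k H (casimir k Λ) = algebraMap k H (counit (R := k) Λ) :=
  mul_antipode_lTensor_comul_apply Λ

/-- `u = S(Λ₍₂₎) Λ₍₁₎` is the opposite product of the Casimir element. -/
theorem uElement_eq_casimir (Λ : H) :
    uElement k Λ = LinearMap.mul' k H (TensorProduct.comm k H H (casimir k Λ)) := by
  unfold uElement casimir
  generalize comul (R := k) Λ = D
  induction D with
  | zero => simp
  | add x y hx hy => simp only [map_add, hx, hy]
  | tmul a b => simp

/-- The element `u` implements the square of the antipode. -/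
theorem IsRightIntegral.uElement_mul {Λ : H} (hΛ : IsRightIntegral k Λ) (h : H) :
    uElement k Λ * h = antipode k (antipode k h) * uElement k Λ := by
  let F : H ⊗[k] H →ₗ[k] H := LinearMap.mul' k H ∘ₗ
    TensorProduct.map (antipode k) LinearMap.id ∘ₗ (TensorProduct.comm k H H).toLinearMap
  have hF : ∀ a b, F (a ⊗ₜ b) = antipode k b * a := fun _ _ => rfl
  have h1 : ∀ D : H ⊗[k] H, F (D * (h ⊗ₜ[k] (1 : H))) = F D * h := by
    intro D
    induction D with
    | zero => simp
    | add x y hx hy => simp only [map_add, hx, hy, add_mul]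
    | tmul a b => simp [hF, mul_assoc]
  have h2 : ∀ D : H ⊗[k] H, F (D * ((1 : H) ⊗ₜ[k] antipode k h)) =
      antipode k (antipode k h) * F D := by
    intro D
    induction D with
    | zero => simp
    | add x y hx hy => simp only [map_add, hx, hy, mul_add, add_mul]
    | tmul a b => simp [hF, antipode_mul_antidistrib, mul_assoc]
  have e := congrArg F (hΛ.comul_mul_tmul_one h)
  rwa [h1, h2] at e

end Integral

/-! ### Integrals of semisimple Hopf algebras and invertibility of `u` -/

section Semisimple

variable {k : Type*} {H : Type*} [Field k] [Ring H] [HopfAlgebra k H]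

open Coalgebra HopfAlgebra TensorProduct

/-- The integral spans a left ideal complementary to the augmentation ideal. -/
theorem exists_isLeftIntegral_counit_eq_one [IsSemisimpleRing H] :
    ∃ Λ : H, IsLeftIntegral k Λ ∧ counit (R := k) Λ = 1 := by
  let K : Submodule H H :=
    { carrier := {x | counit (R := k) x = 0}
      add_mem' := fun {a b} ha hb => by simp_all
      zero_mem' := by simp
      smul_mem' := fun a x hx => by simp_all }
  have hK : ∀ x, x ∈ K ↔ counit (R := k) x = 0 := fun _ => Iff.rfl
  obtain ⟨I, hI⟩ := exists_isCompl K
  obtain ⟨a, ha, Λ, hΛ, h1⟩ :=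
    Submodule.mem_sup.1 (hI.sup_eq_top ▸ Submodule.mem_top (x := (1 : H)))
  have hε : counit (R := k) Λ = 1 := by
    have := congrArg (counit (R := k)) h1
    rw [map_add, (hK a).1 ha, zero_add, Bialgebra.counit_one] at this
    exact this
  refine ⟨Λ, fun h => ?_, hε⟩
  rw [← sub_eq_zero]
  refine Submodule.disjoint_def.1 hI.disjoint _ ?_ ?_
  · simp [hK, hε]
  · rw [Algebra.smul_def, ← sub_mul]
    exact I.smul_mem _ hΛ

theorem exists_isRightIntegral_counit_eq_one [IsSemisimpleRing H] :
    ∃ Λ : H, IsRightIntegral k Λ ∧ counit (R := k) Λ = 1 := by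
  let K : Submodule Hᵐᵒᵖ H :=
    { carrier := {x | counit (R := k) x = 0}
      add_mem' := fun {a b} ha hb => by simp_all
      zero_mem' := by simp
      smul_mem' := fun a x hx => by simp_all }
  have hK : ∀ x, x ∈ K ↔ counit (R := k) x = 0 := fun _ => Iff.rfl
  obtain ⟨I, hI⟩ := exists_isCompl K
  obtain ⟨a, ha, Λ, hΛ, h1⟩ :=
    Submodule.mem_sup.1 (hI.sup_eq_top ▸ Submodule.mem_top (x := (1 : H)))
  have hε : counit (R := k) Λ = 1 := by
    have := congrArg (counit (R := k)) h1
    rw [map_add, (hK a).1 ha, zero_add, Bialgebra.counit_one] at this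
    exact this
  refine ⟨Λ, fun h => ?_, hε⟩
  rw [← sub_eq_zero]
  refine Submodule.disjoint_def.1 hI.disjoint _ ?_ ?_
  · simp [hK, hε]
  · rw [Algebra.smul_def, Algebra.commutes, ← mul_sub]
    exact I.smul_mem (MulOpposite.op _) hΛ

/-- A semisimple Hopf algebra has a two-sided integral `Λ` with `ε(Λ) = 1`. -/
theorem exists_isIntegral_counit_eq_one (k : Type*) (H : Type*) [Field k] [Ring H]
    [HopfAlgebra k H] [IsSemisimpleRing H] :
    ∃ Λ : H, IsLeftIntegral k Λ ∧ IsRightIntegral k Λ ∧ counit (R := k) Λ = 1 := by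
  obtain ⟨Λ, hΛ, h1⟩ := exists_isLeftIntegral_counit_eq_one (k := k) (H := H)
  obtain ⟨Λ', hΛ', h1'⟩ := exists_isRightIntegral_counit_eq_one (k := k) (H := H)
  have h : Λ = Λ' := by
    have e1 := hΛ Λ'
    have e2 := hΛ' Λ
    rw [h1', one_smul] at e1
    rw [h1, one_smul] at e2
    exact e1.symm.trans e2
  exact ⟨Λ, hΛ, h ▸ hΛ', h1⟩

/-- Integrals are unique up to scalars. -/
theorem IsLeftIntegral.eq_smul {Λ Λ' : H} (hΛ' : IsLeftIntegral k Λ')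
    (hr : IsRightIntegral k Λ) (h1 : counit (R := k) Λ = 1) :
    Λ' = counit (R := k) Λ' • Λ := by
  rw [← hr Λ', hΛ' Λ, h1, one_smul]

/-- On a matrix block of size `d`, the Casimir element `x ⊗ y` has the form
`∑ E_{ij} ⊗ c E_{ji}` with `tr c = ε(Λ)`, whence `u = y x` acts as `d c ≠ 0`; the kernel of `u` is
stable under `H` because `u h = S²(h) u`, so `u` acts invertibly. -/
theorem isUnit_map_uElement {Λ : H} (hl : IsLeftIntegral k Λ) (hr : IsRightIntegral k Λ)
    (h1 : counit (R := k) Λ = 1) {d : ℕ} (hd : (d : k) ≠ 0)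
    (π : H →ₐ[k] Matrix (Fin d) (Fin d) k) (hπ : Function.Surjective π) :
    IsUnit (π (uElement k Λ)) := by
  -- `F X = ∑ π(x) X π(y)`, as a linear map in the tensor
  let F : Matrix (Fin d) (Fin d) k → H ⊗[k] H →ₗ[k] Matrix (Fin d) (Fin d) k := fun X =>
    LinearMap.mul' k _ ∘ₗ TensorProduct.map (LinearMap.mulRight k X ∘ₗ π.toLinearMap) π.toLinearMap
  have hF : ∀ X a b, F X (a ⊗ₜ b) = π a * X * π b := fun _ _ _ => rfl
  have hFl : ∀ X a D, F X ((a ⊗ₜ[k] (1 : H)) * D) = π a * F X D := by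
    intro X a D
    induction D with
    | zero => simp
    | add x y hx hy => simp only [map_add, hx, hy, mul_add]
    | tmul x y => simp [hF, mul_assoc]
  have hFr : ∀ X a D, F X (D * ((1 : H) ⊗ₜ[k] a)) = F X D * π a := by
    intro X a D
    induction D with
    | zero => simp
    | add x y hx hy => simp only [map_add, hx, hy, add_mul]
    | tmul x y => simp [hF, mul_assoc]
  have hcomm : ∀ X, ∃ c : k, F X (casimir k Λ) = Matrix.scalar (Fin d) c := by
    intro X
    have : ∀ A, Commute (F X (casimir k Λ)) A := by
      intro A
      obtain ⟨a, rfl⟩ := hπ A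
      rw [commute_iff_eq, ← hFr, ← hl.tmul_one_mul_casimir, hFl]
    obtain ⟨c, hc⟩ := Matrix.mem_range_scalar_of_commute_single (fun i j _ => (this _).symm)
    exact ⟨c, hc.symm⟩
  choose f hf using hcomm
  have hF1 : F 1 (casimir k Λ) = 1 := by
    have : ∀ D, F 1 D = π (LinearMap.mul' k H D) := by
      intro D
      induction D with
      | zero => simp
      | add x y hx hy => simp only [map_add, hx, hy]
      | tmul x y => simp [hF]
    rw [this, mul'_casimir, h1, map_one, map_one]
  -- the matrix entries of `π u`
  have hu : ∀ b c, π (uElement k Λ) c b = d * f (Matrix.single b c 1) := by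
    intro b c
    have key : ∀ D : H ⊗[k] H, π (LinearMap.mul' k H (TensorProduct.comm k H H D)) c b =
        ∑ a, F (Matrix.single b c 1) D a a := by
      intro D
      induction D with
      | zero => simp
      | add x y hx hy => simp only [map_add, Matrix.add_apply, hx, hy, Finset.sum_add_distrib]
      | tmul x y =>
        simp only [TensorProduct.comm_tmul, LinearMap.mul'_apply, map_mul, hF, Matrix.mul_apply]
        refine Finset.sum_congr rfl fun a _ => ?_
        simp [Matrix.single_apply, Finset.sum_ite_eq, mul_comm, ite_and]
    rw [uElement_eq_casimir, key, hf]
    simp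
  have hne : π (uElement k Λ) ≠ 0 := by
    intro h0
    have hf0 : ∀ b c, f (Matrix.single b c 1) = 0 := by
      intro b c
      have := hu b c
      rw [h0, Matrix.zero_apply] at this
      exact (mul_eq_zero.1 this.symm).resolve_left hd
    have hadd : F 1 (casimir k Λ) = ∑ b, F (Matrix.single b b 1) (casimir k Λ) := by
      generalize casimir k Λ = D
      induction D with
      | zero => simp
      | add x y hx hy => simp only [map_add, hx, hy, Finset.sum_add_distrib]
      | tmul x y =>
        simp only [hF, ← Finset.sum_mul, ← Finset.mul_sum]
        congr 2
        ext i j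
        simp [Matrix.sum_apply, Matrix.single_apply, Matrix.one_apply, ite_and]
    rw [hF1] at hadd
    simp only [hf, hf0, map_zero, Finset.sum_const_zero] at hadd
    have : NeZero d := ⟨fun h => hd (by simp [h])⟩
    exact one_ne_zero hadd
  rw [← Matrix.mulVec_injective_iff_isUnit, ← Matrix.coe_mulVecLin, injective_iff_map_eq_zero]
  intro v hv
  by_contra hv0
  apply hne
  -- every vector is of the form `A v`, and `π u` kills it
  obtain ⟨i, hi⟩ : ∃ i, v i ≠ 0 := by
    by_contra hc
    push Not at hc
    exact hv0 (funext hc)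
  ext r s
  obtain ⟨a, ha⟩ := hπ (Matrix.single s i (v i)⁻¹)
  have h2 : (π (uElement k Λ)).mulVec ((π a).mulVec v) = 0 := by
    rw [Matrix.mulVec_mulVec, ← map_mul, hr.uElement_mul, map_mul, ← Matrix.mulVec_mulVec]
    rw [Matrix.mulVecLin_apply] at hv
    rw [hv, Matrix.mulVec_zero]
  have h3 : (π a).mulVec v = Pi.single s 1 := by
    rw [ha]
    ext j
    simp [Matrix.mulVec, dotProduct, Matrix.single_apply, Pi.single_apply, ite_and, hi,
      eq_comm]
  rw [h3] at h2
  simpa using congrFun h2 r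

/-- The hypothesis on the characteristic guarantees that the dimensions of the simple modules are
nonzero in `k`. -/
theorem isUnit_uElement [IsAlgClosed k] (p : ℕ) [CharP k p] [Module.Finite k H]
    [IsSemisimpleRing H] (hp : p = 0 ∨ Module.finrank k H < p ^ 2) {Λ : H}
    (hl : IsLeftIntegral k Λ) (hr : IsRightIntegral k Λ) (h1 : counit (R := k) Λ = 1) :
    IsUnit (uElement k Λ) := by
  obtain ⟨n, d, hd, ⟨e⟩⟩ := IsSemisimpleRing.exists_algEquiv_pi_matrix_of_isAlgClosed k H
  rw [← MulEquiv.isUnit_map e, Pi.isUnit_iff]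
  intro i
  let π : H →ₐ[k] Matrix (Fin (d i)) (Fin (d i)) k :=
    (Pi.evalAlgHom k (fun i => Matrix (Fin (d i)) (Fin (d i)) k) i).comp e.toAlgHom
  have hπ : Function.Surjective π :=
    (Function.surjective_eval i).comp e.surjective
  refine isUnit_map_uElement hl hr h1 ?_ π hπ
  rw [Ne, CharP.cast_eq_zero_iff k p]
  intro hdvd
  have hpos : 0 < d i := Nat.pos_of_ne_zero (NeZero.ne _)
  rcases hp with rfl | hp
  · exact hpos.ne' (zero_dvd_iff.1 hdvd)
  · have hle := LinearMap.finrank_le_finrank_of_surjective (f := π.toLinearMap) hπ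
    rw [Module.finrank_matrix, Fintype.card_fin, Module.finrank_self, mul_one, ← sq] at hle
    exact (lt_of_pow_lt_pow_left₀ 2 (Nat.zero_le _) (hle.trans_lt hp)).not_ge
      (Nat.le_of_dvd hpos hdvd)

/-- Since `u` implements `S²`, the antipode is surjective as soon as `u` is invertible. -/
theorem antipode_surjective_of_isUnit {Λ : H} (hr : IsRightIntegral k Λ)
    (hu : IsUnit (uElement k Λ)) : Function.Surjective (antipode k : H →ₗ[k] H) := by
  intro h
  obtain ⟨u, hu⟩ := hu
  refine ⟨antipode k ((u⁻¹ : Hˣ) * h * u), ?_⟩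
  have := hr.uElement_mul ((u⁻¹ : Hˣ) * h * u)
  rw [← hu, ← mul_assoc, ← mul_assoc, Units.mul_inv, one_mul] at this
  exact (Units.mul_left_inj u).1 this.symm

end Semisimple

/-! ### The indicator in terms of the central element `S(u) u` -/

section Trace

variable {k : Type*} {H : Type*} [Field k] [Ring H] [HopfAlgebra k H]

open Coalgebra HopfAlgebra TensorProduct

theorem isUnit_antipode {x : H} (hx : IsUnit x) : IsUnit (antipode k x) := by
  obtain ⟨⟨x, y, hxy, hyx⟩, rfl⟩ := hx
  exact ⟨⟨antipode k x, antipode k y,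
    by rw [← antipode_mul_antidistrib, hyx, antipode_one],
    by rw [← antipode_mul_antidistrib, hxy, antipode_one]⟩, rfl⟩

/-- `S(u) u` is central, since both `u` and `S(u)⁻¹` implement `S²`. -/
theorem IsRightIntegral.antipode_uElement_mul_uElement_central {Λ : H}
    (hr : IsRightIntegral k Λ) (hS : Function.Surjective (antipode k : H →ₗ[k] H)) (h : H) :
    Commute (antipode k (uElement k Λ) * uElement k Λ) h := by
  obtain ⟨g, rfl⟩ := hS h
  have e := congrArg (antipode k) (hr.uElement_mul g)
  rw [antipode_mul_antidistrib, antipode_mul_antidistrib] at e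
  rw [commute_iff_eq, mul_assoc, hr.uElement_mul, ← mul_assoc, ← mul_assoc, e]

variable {V : Type*} [AddCommGroup V] [Module k V]

/-- `S(u) = S(Λ₍₁₎) S²(Λ₍₂₎)`, and exchanging the two factors gives
`S(Λ₍₁₎ S(Λ₍₂₎)) = ε(Λ) 1`; under a trace the exchange is harmless. -/
theorem trace_mul_antipode_uElement (ρ : H →ₐ[k] Module.End k V) (Λ : H) {w : H}
    (hw : ∀ h, Commute w h) :
    LinearMap.trace k V (ρ (w * antipode k (uElement k Λ))) =
      counit (R := k) Λ * LinearMap.trace k V (ρ w) := by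
  have key : ∀ D : H ⊗[k] H,
      LinearMap.trace k V (ρ (w * antipode k (LinearMap.mul' k H (TensorProduct.map (antipode k)
        LinearMap.id (TensorProduct.comm k H H D))))) =
      LinearMap.trace k V (ρ (w * antipode k (LinearMap.mul' k H ((antipode k).lTensor H D)))) := by
    intro D
    induction D with
    | zero => simp
    | add x y hx hy => simp only [map_add, mul_add, hx, hy]
    | tmul a b =>
      simp only [TensorProduct.comm_tmul, TensorProduct.map_tmul, LinearMap.mul'_apply,
        LinearMap.id_apply, LinearMap.lTensor_tmul, antipode_mul_antidistrib]
      rw [← mul_assoc, map_mul, LinearMap.trace_mul_comm, ← map_mul, ← mul_assoc,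
        ← (hw _).eq, mul_assoc]
  rw [uElement, key, mul_antipode_lTensor_comul_apply, Algebra.algebraMap_eq_smul_one]
  simp

theorem fsIndicator_eq (ρ : H →ₐ[k] Module.End k V) {Λ : H} (hr : IsRightIntegral k Λ)
    (hu : IsUnit (uElement k Λ)) {n : ℤ} (hP : ∀ h, Commute (sweedlerPower k n Λ) h) :
    fsIndicator k Λ ρ n = counit (R := k) Λ * LinearMap.trace k V
      (ρ (Ring.inverse (antipode k (uElement k Λ) * uElement k Λ) * sweedlerPower k n Λ)) := by
  have hS := antipode_surjective_of_isUnit hr hu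
  have hz := hr.antipode_uElement_mul_uElement_central hS
  obtain ⟨u, hu'⟩ := hu
  obtain ⟨s, hs⟩ := isUnit_antipode (k := k) ⟨u, hu'⟩
  have hzc : ∀ h, Commute ((s * u)⁻¹ : Hˣ).val h := fun h => by
    have : Commute ((s * u : Hˣ) : H) h := by
      rw [Units.val_mul, hs, hu']; exact hz h
    exact this.units_inv_left
  rw [← trace_mul_antipode_uElement]
  · unfold fsIndicator
    congr 2
    rw [← hs, ← hu', ← Units.val_mul, Ring.inverse_unit, Ring.inverse_unit, mul_assoc,
      (hP s).eq, ← mul_assoc]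
    congr 1
    rw [← Units.val_mul]
    have := hzc s
    have h2 : ((s * u)⁻¹ : Hˣ) * s = s * (s * u)⁻¹ := Units.ext this
    rw [h2]
    congr 1
    -- `s (s u)⁻¹ = s u⁻¹ s⁻¹`, which is `u⁻¹` because `s` commutes with `(s u)⁻¹`
    rw [← h2, mul_inv_rev, inv_mul_cancel_right]
  · intro h
    rw [← hs, ← hu', ← Units.val_mul, Ring.inverse_unit]
    exact (hzc h).mul_left (hP h)

theorem uElement_smul (c : k) (Λ : H) : uElement k (c • Λ) = c • uElement k Λ := by
  simp [uElement]

theorem isUnit_uElement_smul {c : k} (hc : c ≠ 0) {Λ : H} (hu : IsUnit (uElement k Λ)) :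
    IsUnit (uElement k (c • Λ)) := by
  obtain ⟨u, hu⟩ := hu
  rw [uElement_smul, ← hu]
  exact (Units.mk0 c hc • u).isUnit

theorem fsIndicator_smul {c : k} (hc : c ≠ 0) {Λ : H} (hu : IsUnit (uElement k Λ))
    (ρ : H →ₐ[k] Module.End k V) (n : ℤ) :
    fsIndicator k (c • Λ) ρ n = fsIndicator k Λ ρ n := by
  obtain ⟨u, hu⟩ := hu
  have : Ring.inverse (c • uElement k Λ) = c⁻¹ • Ring.inverse (uElement k Λ) := by
    have h : c • (u : H) = (Units.mk0 c hc • u : Hˣ) := rfl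
    rw [← hu, h, Ring.inverse_unit, Ring.inverse_unit]
    rfl
  rw [fsIndicator, fsIndicator, uElement_smul, this, map_smul, smul_mul_smul_comm,
    inv_mul_cancel₀ hc, one_smul]

end Trace

/-! ### Tensor powers of `H` and iterated twists -/

section TensorPower

open Coalgebra HopfAlgebra TensorProduct

section Products

variable {k : Type*} {H : Type*} [Field k] [Ring H] [HopfAlgebra k H]
  {A : Type*} [Ring A] [Algebra k A]

/-- The map `h ⊗ x ↦ h μ(x)`; it extends an ordered product `μ` by one factor on the left. -/
def consMul (μ : A →ₗ[k] H) : H ⊗[k] A →ₗ[k] H :=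
  LinearMap.mul' k H ∘ₗ μ.lTensor H

/-- The map `h ⊗ x ↦ μ(x) h`; it extends a reversed product `μ` by one factor. -/
def consMulRev (μ : A →ₗ[k] H) : H ⊗[k] A →ₗ[k] H :=
  LinearMap.mul' k H ∘ₗ (TensorProduct.comm k H H).toLinearMap ∘ₗ μ.lTensor H

@[simp] theorem consMul_tmul (μ : A →ₗ[k] H) (h : H) (x : A) :
    consMul μ (h ⊗ₜ x) = h * μ x := rfl

@[simp] theorem consMulRev_tmul (μ : A →ₗ[k] H) (h : H) (x : A) :
    consMulRev μ (h ⊗ₜ x) = μ x * h := rfl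

theorem consMul_tmul_one_mul (μ : A →ₗ[k] H) (h : H) (y : H ⊗[k] A) :
    consMul μ ((h ⊗ₜ[k] (1 : A)) * y) = h * consMul μ y := by
  induction y with
  | zero => simp
  | add x y hx hy => simp only [map_add, mul_add, hx, hy]
  | tmul a b => simp [mul_assoc]

theorem consMulRev_mul_tmul_one (μ : A →ₗ[k] H) (h : H) (y : H ⊗[k] A) :
    consMulRev μ (y * (h ⊗ₜ[k] (1 : A))) = consMulRev μ y * h := by
  induction y with
  | zero => simp
  | add x y hx hy => simp only [map_add, add_mul, hx, hy]
  | tmul a b => simp [mul_assoc]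

end Products

universe u v

/-- A tensor power of `H` (as an algebra `A`), with the data relating it to the next one `H ⊗ A`:
the iterated comultiplication `D`, the identification `τ` of `A ⊗ H` with `H ⊗ A`, the ordered and
reversed products `mul` and `mulRev` of the tensor factors, and the iterated twist `j`, so that the
iterated comultiplication of `H^J` is `j⁻¹ D(·) j`. The laws `mul_cancel` and `mulRev_cancel` say
that in `a₁ z₁ x₁ a₂ z₂ x₂ ⋯` only the products of the adjacent factors `z` and `x` matter. -/
structure TensorPower {k : Type u} {H : Type v} [Field k] [Ring H] [HopfAlgebra k H]
    (T : Twist k H) where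
  /-- the underlying algebra `H ⊗ ⋯ ⊗ H` -/
  A : Type v
  [ring : Ring A]
  [algebra : Algebra k A]
  /-- the iterated comultiplication -/
  D : H →ₐ[k] A
  /-- the canonical map from `A ⊗ H` to `H ⊗ A` -/
  τ : A ⊗[k] H →ₐ[k] H ⊗[k] A
  /-- the product `a₁ ⊗ ⋯ ⊗ aₙ ↦ a₁ ⋯ aₙ` -/
  mul : A →ₗ[k] H
  /-- the reversed product `a₁ ⊗ ⋯ ⊗ aₙ ↦ aₙ ⋯ a₁` -/
  mulRev : A →ₗ[k] H
  /-- the iterated twist -/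
  j : Aˣ
  τ_map_comul : ∀ a : H, τ (Algebra.TensorProduct.map D (AlgHom.id k H) (comul (R := k) a)) =
    Algebra.TensorProduct.map (AlgHom.id k H) D (comul (R := k) a)
  τ_map_twist : τ (Algebra.TensorProduct.map D (AlgHom.id k H) T.J * ((j : A) ⊗ₜ[k] (1 : H))) =
    Algebra.TensorProduct.map (AlgHom.id k H) D T.J * ((1 : H) ⊗ₜ[k] (j : A))
  mul_cancel : ∀ (x z : A) (y : H ⊗[k] A),
    consMul mul (((1 : H) ⊗ₜ[k] x) * y * τ (z ⊗ₜ[k] (1 : H))) =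
      consMul mul (y * τ ((z * x) ⊗ₜ[k] (1 : H)))
  mul_last : ∀ (y : H ⊗[k] A) (h : H),
    consMul mul (y * τ ((1 : A) ⊗ₜ[k] h)) = consMul mul y * h
  mulRev_cancel : ∀ (x z : A) (y : H ⊗[k] A),
    consMulRev mulRev (τ (x ⊗ₜ[k] (1 : H)) * y * ((1 : H) ⊗ₜ[k] z)) =
      consMulRev mulRev (y * ((1 : H) ⊗ₜ[k] (z * x)))
  mulRev_last : ∀ (y : H ⊗[k] A) (h : H),
    consMulRev mulRev (τ ((1 : A) ⊗ₜ[k] h) * y) = h * consMulRev mulRev y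

namespace TensorPower

attribute [instance] TensorPower.ring TensorPower.algebra

variable {k : Type u} {H : Type v} [Field k] [Ring H] [HopfAlgebra k H] {T : Twist k H}

/-- The first tensor power, `H` itself. -/
abbrev base (T : Twist k H) : TensorPower T where
  A := H
  D := AlgHom.id k H
  τ := AlgHom.id k (H ⊗[k] H)
  mul := LinearMap.id
  mulRev := LinearMap.id
  j := 1
  τ_map_comul _ := rfl
  τ_map_twist := rfl
  mul_cancel x z y := by
    induction y with
    | zero => simp
    | add a b ha hb => simp only [map_add, mul_add, add_mul, ha, hb]
    | tmul a b => simp [mul_assoc]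
  mul_last y h := by
    induction y with
    | zero => simp
    | add a b ha hb => simp only [map_add, add_mul, ha, hb]
    | tmul a b => simp [mul_assoc]
  mulRev_cancel x z y := by
    induction y with
    | zero => simp
    | add a b ha hb => simp only [map_add, mul_add, add_mul, ha, hb]
    | tmul a b => simp [mul_assoc]
  mulRev_last y h := by
    induction y with
    | zero => simp
    | add a b ha hb => simp only [map_add, mul_add, ha, hb]
    | tmul a b => simp [mul_assoc]

variable (L : TensorPower T)

/-- The iterated comultiplication with values in `H ⊗ A`. -/
def succD : H →ₐ[k] H ⊗[k] L.A :=
  (Algebra.TensorProduct.map (AlgHom.id k H) L.D).comp (Bialgebra.comulAlgHom k H)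

/-- The map `(H ⊗ A) ⊗ H → H ⊗ (H ⊗ A)` induced by `τ`. -/
def succτ : (H ⊗[k] L.A) ⊗[k] H →ₐ[k] H ⊗[k] (H ⊗[k] L.A) :=
  (Algebra.TensorProduct.map (AlgHom.id k H) L.τ).comp
    (Algebra.TensorProduct.assoc k k k H L.A H).toAlgHom

/-- The iterated twist `(id ⊗ D)(J) (1 ⊗ j)` in `H ⊗ A`. -/
def succJ : (H ⊗[k] L.A)ˣ :=
  Units.map (Algebra.TensorProduct.map (AlgHom.id k H) L.D : H ⊗[k] H →* H ⊗[k] L.A) T.J *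
    Units.map (Algebra.TensorProduct.includeRight : L.A →ₐ[k] H ⊗[k] L.A).toMonoidHom L.j

theorem coe_succJ : (L.succJ : H ⊗[k] L.A) =
    Algebra.TensorProduct.map (AlgHom.id k H) L.D T.J * ((1 : H) ⊗ₜ[k] (L.j : L.A)) := rfl

theorem coe_succJ_inv : ((L.succJ⁻¹ : (H ⊗[k] L.A)ˣ) : H ⊗[k] L.A) =
    ((1 : H) ⊗ₜ[k] ((L.j⁻¹ : L.Aˣ) : L.A)) *
      Algebra.TensorProduct.map (AlgHom.id k H) L.D ((T.J⁻¹ : (H ⊗[k] H)ˣ) : H ⊗[k] H) := by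
  rw [succJ, mul_inv_rev]
  rfl

theorem coe_succJ_inv' : ((L.succJ⁻¹ : (H ⊗[k] L.A)ˣ) : H ⊗[k] L.A) =
    L.τ ((((L.j⁻¹ : L.Aˣ) : L.A) ⊗ₜ[k] (1 : H)) *
      Algebra.TensorProduct.map L.D (AlgHom.id k H) ((T.J⁻¹ : (H ⊗[k] H)ˣ) : H ⊗[k] H)) := by
  refine Units.inv_eq_of_mul_eq_one_left ?_
  rw [coe_succJ, ← L.τ_map_twist, ← map_mul, mul_assoc,
    ← mul_assoc (Algebra.TensorProduct.map L.D (AlgHom.id k H) _), ← map_mul, Units.inv_mul,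
    map_one, one_mul, Algebra.TensorProduct.tmul_mul_tmul, Units.inv_mul, mul_one,
    ← Algebra.TensorProduct.one_def, map_one]

@[simp] theorem succτ_tmul (h : H) (x : L.A) (g : H) :
    L.succτ ((h ⊗ₜ x) ⊗ₜ g) = h ⊗ₜ L.τ (x ⊗ₜ g) := rfl

/-- The map `H ⊗ (H ⊗ H) → H ⊗ (H ⊗ A)` which comultiplies the middle factor. -/
def midD : H ⊗[k] (H ⊗[k] H) →ₐ[k] H ⊗[k] (H ⊗[k] L.A) :=
  Algebra.TensorProduct.map (AlgHom.id k H)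
    (L.τ.comp (Algebra.TensorProduct.map L.D (AlgHom.id k H)))

theorem succτ_map_succD (X : H ⊗[k] H) :
    L.succτ (Algebra.TensorProduct.map L.succD (AlgHom.id k H) X) =
      L.midD (Algebra.TensorProduct.assoc k k k H H H
        (Algebra.TensorProduct.map (Bialgebra.comulAlgHom k H) (AlgHom.id k H) X)) := by
  induction X with
  | zero => simp
  | add x y hx hy => simp only [map_add, hx, hy]
  | tmul a b =>
    simp only [Algebra.TensorProduct.map_tmul, succD, AlgHom.comp_apply,
      Bialgebra.comulAlgHom_apply, AlgHom.id_apply]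
    generalize comul (R := k) a = E
    induction E with
    | zero => simp
    | add x y hx hy => simp only [map_add, add_tmul, hx, hy]
    | tmul c d => simp [midD]

theorem map_succD (X : H ⊗[k] H) :
    Algebra.TensorProduct.map (AlgHom.id k H) L.succD X =
      L.midD (Algebra.TensorProduct.map (AlgHom.id k H) (Bialgebra.comulAlgHom k H) X) := by
  induction X with
  | zero => simp
  | add x y hx hy => simp only [map_add, hx, hy]
  | tmul a b => simp [midD, succD, L.τ_map_comul]

theorem succτ_map_D (Y : H ⊗[k] H) :
    L.succτ (Algebra.TensorProduct.map (AlgHom.id k H) L.D Y ⊗ₜ[k] (1 : H)) =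
      L.midD (Algebra.TensorProduct.assoc k k k H H H (Y ⊗ₜ[k] (1 : H))) := by
  induction Y with
  | zero => simp
  | add x y hx hy => simp only [map_add, add_tmul, hx, hy]
  | tmul a b => simp [midD]

/-- The next tensor power `H ⊗ A`. -/
abbrev succ : TensorPower T where
  A := H ⊗[k] L.A
  D := L.succD
  τ := L.succτ
  mul := consMul L.mul
  mulRev := consMulRev L.mulRev
  j := L.succJ
  τ_map_comul a := by
    rw [succτ_map_succD, map_succD]
    exact congrArg L.midD (Coalgebra.coassoc_apply a)
  τ_map_twist := by
    have e1 : (L.succJ : H ⊗[k] L.A) ⊗ₜ[k] (1 : H) =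
        (Algebra.TensorProduct.map (AlgHom.id k H) L.D T.J ⊗ₜ[k] (1 : H)) *
          (((1 : H) ⊗ₜ[k] (L.j : L.A)) ⊗ₜ[k] (1 : H)) := by
      rw [coe_succJ, Algebra.TensorProduct.tmul_mul_tmul, one_mul]
    have e2 : (1 : H) ⊗ₜ[k] (L.succJ : H ⊗[k] L.A) =
        L.midD ((1 : H) ⊗ₜ[k] (T.J : H ⊗[k] H)) *
          ((1 : H) ⊗ₜ[k] L.τ ((L.j : L.A) ⊗ₜ[k] (1 : H))) := by
      rw [coe_succJ, ← L.τ_map_twist, midD, Algebra.TensorProduct.map_tmul,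
        Algebra.TensorProduct.tmul_mul_tmul, map_mul, map_one, one_mul]
      rfl
    rw [e1, e2, map_mul, map_mul, succτ_map_succD, map_succD, succτ_map_D, succτ_tmul,
      ← mul_assoc, ← mul_assoc, ← map_mul, ← map_mul, ← map_mul, T.cocycle]
  mul_cancel x z y := by
    induction y with
    | zero => simp
    | add a b ha hb => simp only [map_add, mul_add, add_mul, ha, hb]
    | tmul h y =>
      induction x with
      | zero => simp
      | add a b ha hb =>
        simp only [map_add, mul_add, add_mul, add_tmul, tmul_add, ha, hb]
      | tmul b x =>
        induction z with
        | zero => simp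
        | add a b ha hb => simp only [map_add, mul_add, add_mul, add_tmul, ha, hb]
        | tmul c z =>
          have e : b ⊗ₜ[k] x = ((1 : H) ⊗ₜ[k] x) * (b ⊗ₜ[k] (1 : L.A)) := by simp
          simp only [Algebra.TensorProduct.tmul_mul_tmul, succτ_tmul, consMul_tmul, one_mul]
          rw [e, mul_assoc ((1 : H) ⊗ₜ[k] x), L.mul_cancel, mul_assoc (b ⊗ₜ[k] (1 : L.A)),
            consMul_tmul_one_mul]
          simp only [mul_assoc]
  mul_last y g := by
    induction y with
    | zero => simp
    | add a b ha hb => simp only [map_add, add_mul, ha, hb]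
    | tmul h y =>
      rw [Algebra.TensorProduct.one_def, succτ_tmul, Algebra.TensorProduct.tmul_mul_tmul,
        consMul_tmul, L.mul_last, mul_one, consMul_tmul, mul_assoc]
  mulRev_cancel x z y := by
    induction y with
    | zero => simp
    | add a b ha hb => simp only [map_add, mul_add, add_mul, ha, hb]
    | tmul h y =>
      induction x with
      | zero => simp
      | add a b ha hb =>
        simp only [map_add, mul_add, add_mul, add_tmul, tmul_add, ha, hb]
      | tmul b x =>
        induction z with
        | zero => simp
        | add a b ha hb => simp only [map_add, mul_add, add_mul, tmul_add, ha, hb]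
        | tmul c z =>
          have e1 : c ⊗ₜ[k] z = (c ⊗ₜ[k] (1 : L.A)) * ((1 : H) ⊗ₜ[k] z) := by simp
          have e2 : (c * b) ⊗ₜ[k] (z * x) =
            (c ⊗ₜ[k] (1 : L.A)) * ((1 : H) ⊗ₜ[k] (z * x)) * (b ⊗ₜ[k] (1 : L.A)) := by simp
          simp only [Algebra.TensorProduct.tmul_mul_tmul, succτ_tmul, consMulRev_tmul, mul_one]
          rw [e2, e1, mul_assoc (L.τ _) y, ← mul_assoc y (c ⊗ₜ[k] (1 : L.A)),
            ← mul_assoc (L.τ _), L.mulRev_cancel, ← mul_assoc y (_ * _),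
            consMulRev_mul_tmul_one]
          simp only [mul_assoc]
  mulRev_last y g := by
    induction y with
    | zero => simp
    | add a b ha hb => simp only [map_add, mul_add, ha, hb]
    | tmul h y =>
      rw [Algebra.TensorProduct.one_def, succτ_tmul, Algebra.TensorProduct.tmul_mul_tmul,
        consMulRev_tmul, L.mulRev_last, one_mul, consMulRev_tmul, mul_assoc]

end TensorPower

end TensorPower

/-! ### Sweedler powers of integrals -/

section SweedlerPower

universe u v

variable {k : Type u} {H : Type v} [Field k] [Ring H] [HopfAlgebra k H] {T : Twist k H}

open Coalgebra HopfAlgebra TensorProduct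

namespace Twist

/-- An integral absorbs the inverse twist: the second leg of `J⁻¹` moves through `Δ(Λ)` to the
first as its antipode, which produces `Q_J⁻¹`. -/
theorem inv_mul_comul (T : Twist k H) {Λ : H} (hl : IsLeftIntegral k Λ) :
    ((T.J⁻¹ : (H ⊗[k] H)ˣ) : H ⊗[k] H) * comul (R := k) Λ =
      (T.qInv ⊗ₜ[k] (1 : H)) * comul (R := k) Λ := by
  rw [qInv]
  generalize ((T.J⁻¹ : (H ⊗[k] H)ˣ) : H ⊗[k] H) = K
  induction K with
  | zero => simp
  | add x y hx hy => simp only [map_add, add_mul, add_tmul, hx, hy]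
  | tmul a b =>
    have e1 : a ⊗ₜ[k] b = (a ⊗ₜ[k] (1 : H)) * ((1 : H) ⊗ₜ[k] b) := by simp
    rw [e1, mul_assoc, hl.one_tmul_mul_comul, ← mul_assoc]
    simp

theorem comul_mul_J (T : Twist k H) {Λ : H} (hr : IsRightIntegral k Λ) :
    comul (R := k) Λ * (T.J : H ⊗[k] H) = comul (R := k) Λ * ((1 : H) ⊗ₜ[k] T.q) := by
  rw [q]
  generalize (T.J : H ⊗[k] H) = K
  induction K with
  | zero => simp
  | add x y hx hy => simp only [map_add, mul_add, tmul_add, hx, hy]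
  | tmul a b =>
    have e1 : a ⊗ₜ[k] b = (a ⊗ₜ[k] (1 : H)) * ((1 : H) ⊗ₜ[k] b) := by simp
    rw [e1, ← mul_assoc, hr.comul_mul_tmul_one, mul_assoc]
    simp

end Twist

namespace TensorPower

variable (L : TensorPower T)

theorem succD_apply (a : H) :
    L.succD a = Algebra.TensorProduct.map (AlgHom.id k H) L.D (comul (R := k) a) := rfl

theorem succD_apply' (a : H) :
    L.succD a = L.τ (Algebra.TensorProduct.map L.D (AlgHom.id k H) (comul (R := k) a)) :=
  (L.τ_map_comul a).symm

/-- Ordered products `Λ₍₁₎ ⋯ Λ₍ₙ₎` of two-sided integrals are central: an element moves from the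
left of `Λ₍₁₎` to `Λ₍₂₎ ⋯ Λ₍ₙ₎`, whence through `Λ₍₁₎ ⋯ Λ₍ₙ₋₁₎` to the right of `Λ₍ₙ₎`. -/
theorem consMul_succD_central {Λ : H} (hl : IsLeftIntegral k Λ) (hr : IsRightIntegral k Λ)
    (hS : Function.Surjective (antipode k : H →ₗ[k] H)) (h : H) :
    Commute (consMul L.mul (L.succD Λ)) h := by
  obtain ⟨g, rfl⟩ := hS h
  have e1 : (antipode k g ⊗ₜ[k] (1 : L.A)) * L.succD Λ =
      ((1 : H) ⊗ₜ[k] L.D g) * L.succD Λ := by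
    have := congrArg (Algebra.TensorProduct.map (AlgHom.id k H) L.D) (hl.one_tmul_mul_comul g)
    simpa [succD_apply] using this.symm
  have e2 : L.succD Λ * L.τ (L.D g ⊗ₜ[k] (1 : H)) =
      L.succD Λ * L.τ ((1 : L.A) ⊗ₜ[k] antipode k g) := by
    have := congrArg (fun X => L.τ (Algebra.TensorProduct.map L.D (AlgHom.id k H) X))
      (hr.comul_mul_tmul_one g)
    simpa [succD_apply'] using this
  have e3 := L.mul_cancel (L.D g) 1 (L.succD Λ)
  rw [one_mul, ← Algebra.TensorProduct.one_def, map_one, mul_one, ← e1, e2,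
    consMul_tmul_one_mul, L.mul_last] at e3
  exact e3.symm

/-- Reversed products `Λ₍ₙ₎ ⋯ Λ₍₁₎` of two-sided integrals are central. -/
theorem consMulRev_succD_central {Λ : H} (hl : IsLeftIntegral k Λ) (hr : IsRightIntegral k Λ)
    (h : H) : Commute (consMulRev L.mulRev (L.succD Λ)) h := by
  have e1 : L.τ ((1 : L.A) ⊗ₜ[k] h) * L.succD Λ =
      L.τ (L.D (antipode k h) ⊗ₜ[k] (1 : H)) * L.succD Λ := by
    have := congrArg (fun X => L.τ (Algebra.TensorProduct.map L.D (AlgHom.id k H) X))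
      (hl.one_tmul_mul_comul h)
    simpa [succD_apply'] using this
  have e2 : L.succD Λ * (h ⊗ₜ[k] (1 : L.A)) =
      L.succD Λ * ((1 : H) ⊗ₜ[k] L.D (antipode k h)) := by
    have := congrArg (Algebra.TensorProduct.map (AlgHom.id k H) L.D) (hr.comul_mul_tmul_one h)
    simpa [succD_apply] using this
  have e3 := L.mulRev_cancel (L.D (antipode k h)) 1 (L.succD Λ)
  rw [one_mul, ← Algebra.TensorProduct.one_def, mul_one, ← e1, ← e2,
    consMulRev_mul_tmul_one, L.mulRev_last] at e3
  exact e3.symm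

/-- In `j⁻¹ D(Λ) j` one end of `j⁻¹` and one end of `j` are absorbed by the integral as `Q_J⁻¹`
and `Q_J`, and what remains cancels in the ordered product. -/
theorem consMul_twisted {Λ : H} (hl : IsLeftIntegral k Λ) (hr : IsRightIntegral k Λ) :
    consMul L.mul (((L.succJ⁻¹ : (H ⊗[k] L.A)ˣ) : H ⊗[k] L.A) * L.succD Λ * L.succJ) =
      T.qInv * consMul L.mul (L.succD Λ) * T.q := by
  have e1 : ((L.succJ⁻¹ : (H ⊗[k] L.A)ˣ) : H ⊗[k] L.A) * L.succD Λ =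
      ((1 : H) ⊗ₜ[k] ((L.j⁻¹ : L.Aˣ) : L.A)) * ((T.qInv ⊗ₜ[k] (1 : L.A)) * L.succD Λ) := by
    rw [coe_succJ_inv, succD_apply, mul_assoc, ← map_mul, T.inv_mul_comul hl, map_mul]
    simp
  have e2 : L.succD Λ * L.succJ =
      L.succD Λ * L.τ ((1 : L.A) ⊗ₜ[k] T.q) * L.τ ((L.j : L.A) ⊗ₜ[k] (1 : H)) := by
    rw [coe_succJ, ← L.τ_map_twist, succD_apply', ← map_mul, ← mul_assoc, ← map_mul,
      T.comul_mul_J hr, map_mul, map_mul, map_mul]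
    simp
  rw [e1, mul_assoc, mul_assoc, e2, ← mul_assoc (T.qInv ⊗ₜ[k] (1 : L.A)), ← mul_assoc,
    L.mul_cancel, Units.mul_inv, ← Algebra.TensorProduct.one_def, map_one, mul_one,
    consMul_tmul_one_mul, L.mul_last, mul_assoc]

/-- The analogue of `consMul_twisted` for reversed products. There the factors at the ends are
elements `r` and `s` with `S(r) = Q_J⁻¹` and `S(s) = Q_J`. -/
theorem consMulRev_twisted {Λ : H} (hl : IsLeftIntegral k Λ) (hr : IsRightIntegral k Λ)
    {r s : H} (hrq : antipode k r = T.qInv) (hs : antipode k s = T.q) :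
    consMulRev L.mulRev (((L.succJ⁻¹ : (H ⊗[k] L.A)ˣ) : H ⊗[k] L.A) * L.succD Λ * L.succJ) =
      r * consMulRev L.mulRev (L.succD Λ) * s := by
  have e1 : ((L.succJ⁻¹ : (H ⊗[k] L.A)ˣ) : H ⊗[k] L.A) * L.succD Λ =
      L.τ (((L.j⁻¹ : L.Aˣ) : L.A) ⊗ₜ[k] (1 : H)) *
        (L.τ ((1 : L.A) ⊗ₜ[k] r) * L.succD Λ) := by
    rw [coe_succJ_inv', succD_apply', ← map_mul, mul_assoc, ← map_mul, T.inv_mul_comul hl,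
      ← hrq, ← hl.one_tmul_mul_comul]
    simp
  have e2 : L.succD Λ * L.succJ =
      L.succD Λ * (s ⊗ₜ[k] (1 : L.A)) * ((1 : H) ⊗ₜ[k] (L.j : L.A)) := by
    rw [coe_succJ, succD_apply, ← mul_assoc, ← map_mul, T.comul_mul_J hr, ← hs,
      ← hr.comul_mul_tmul_one, map_mul]
    simp
  rw [e1, mul_assoc, mul_assoc, e2, ← mul_assoc (L.τ ((1 : L.A) ⊗ₜ[k] r)), ← mul_assoc,
    L.mulRev_cancel, Units.mul_inv, ← Algebra.TensorProduct.one_def, mul_one,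
    ← mul_assoc, consMulRev_mul_tmul_one, L.mulRev_last]

end TensorPower

theorem toConv_pow_succ_apply (f : H →ₗ[k] H) (n : ℕ) (a : H) :
    (WithConv.toConv f ^ (n + 2)).ofConv a = LinearMap.mul' k H
      (TensorProduct.map f (WithConv.toConv f ^ (n + 1)).ofConv (comul (R := k) a)) := by
  rw [pow_succ']
  rfl

namespace Twist

variable (T : Twist k H)

theorem toOriginal_mul'_map {f g : T.Twisted →ₗ[k] T.Twisted} {f' g' : H →ₗ[k] H}
    (hf : ∀ a, T.toOriginal (f a) = f' (T.toOriginal a))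
    (hg : ∀ a, T.toOriginal (g a) = g' (T.toOriginal a)) (a : T.Twisted) :
    T.toOriginal (LinearMap.mul' k T.Twisted (TensorProduct.map f g (comul (R := k) a))) =
      LinearMap.mul' k H (TensorProduct.map f' g'
        (((T.J⁻¹ : (H ⊗[k] H)ˣ) : H ⊗[k] H) * comul (R := k) (T.toOriginal a) * T.J)) := by
  rw [← T.comul_twisted]
  generalize comul (R := k) a = D
  induction D with
  | zero => simp
  | add x y hx hy => simp only [map_add, hx, hy]
  | tmul x y => simp [hf, hg]

theorem antipode_mul (T : Twist k H) (a b : H) :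
    T.antipode (a * b) = T.antipode b * T.antipode a :=
  antipode_mul_antidistrib (R := k) (A := T.Twisted) a b

end Twist

namespace TensorPower

/-- The tensor power of `H` with `n + 1` factors. -/
def level (T : Twist k H) : ℕ → TensorPower T
  | 0 => base T
  | n + 1 => (level T n).succ

variable (L : TensorPower T)

/-- The conjugate `a ↦ j⁻¹ D(a) j`, the iterated comultiplication of `H^J`. -/
def twistedD : H →ₗ[k] L.A :=
  LinearMap.mulLeft k ((L.j⁻¹ : L.Aˣ) : L.A) ∘ₗ LinearMap.mulRight k (L.j : L.A) ∘ₗ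
    L.D.toLinearMap

theorem twistedD_apply (a : H) :
    L.twistedD a = ((L.j⁻¹ : L.Aˣ) : L.A) * L.D a * L.j :=
  (mul_assoc _ _ _).symm

theorem lTensor_twistedD (a : H) : L.twistedD.lTensor H
    (((T.J⁻¹ : (H ⊗[k] H)ˣ) : H ⊗[k] H) * comul (R := k) a * T.J) = L.succ.twistedD a := by
  have h : ∀ X : H ⊗[k] H, L.twistedD.lTensor H X = ((1 : H) ⊗ₜ[k] ((L.j⁻¹ : L.Aˣ) : L.A)) *
      Algebra.TensorProduct.map (AlgHom.id k H) L.D X * ((1 : H) ⊗ₜ[k] (L.j : L.A)) := by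
    intro X
    induction X with
    | zero => simp
    | add x y hx hy => simp only [map_add, mul_add, add_mul, hx, hy]
    | tmul x y => simp [twistedD_apply]
  rw [h, twistedD_apply, coe_succJ_inv, coe_succJ, succD_apply]
  simp only [map_mul, mul_assoc]

theorem mul'_map_id {A : Type*} [Ring A] [Algebra k A] (μ : A →ₗ[k] H) (f : H →ₗ[k] A)
    (X : H ⊗[k] H) : LinearMap.mul' k H (TensorProduct.map LinearMap.id (μ ∘ₗ f) X) =
      consMul μ (f.lTensor H X) := by
  induction X with
  | zero => simp
  | add x y hx hy => simp only [map_add, hx, hy]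
  | tmul x y => simp

theorem mul'_map_anti {A : Type*} [Ring A] [Algebra k A] (μ : A →ₗ[k] H) (f : H →ₗ[k] A)
    {S : H →ₗ[k] H} (hS : ∀ a b, S (a * b) = S b * S a) (X : H ⊗[k] H) :
    LinearMap.mul' k H (TensorProduct.map S (S ∘ₗ μ ∘ₗ f) X) =
      S (consMulRev μ (f.lTensor H X)) := by
  induction X with
  | zero => simp
  | add x y hx hy => simp only [map_add, hx, hy]
  | tmul x y => simp [hS]

theorem level_mul (T : Twist k H) (n : ℕ) :
    (WithConv.toConv (LinearMap.id : H →ₗ[k] H) ^ (n + 1)).ofConv =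
      (level T n).mul ∘ₗ (level T n).D.toLinearMap := by
  induction n with
  | zero => rw [zero_add, pow_one]; rfl
  | succ n ih =>
    ext a
    rw [toConv_pow_succ_apply, ih, mul'_map_id]
    rfl

/-- Negative Sweedler powers are antipodes of reversed products. -/
theorem level_mulRev (T : Twist k H) (n : ℕ) :
    (WithConv.toConv (antipode k : H →ₗ[k] H) ^ (n + 1)).ofConv =
      antipode k ∘ₗ (level T n).mulRev ∘ₗ (level T n).D.toLinearMap := by
  induction n with
  | zero => rw [zero_add, pow_one]; rfl
  | succ n ih =>
    ext a
    rw [toConv_pow_succ_apply, ih, mul'_map_anti _ _ antipode_mul_antidistrib]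
    rfl

theorem level_mul_twisted (T : Twist k H) (n : ℕ) (a : T.Twisted) : T.toOriginal
    ((WithConv.toConv (LinearMap.id : T.Twisted →ₗ[k] T.Twisted) ^ (n + 1)).ofConv a) =
      ((level T n).mul ∘ₗ (level T n).twistedD) (T.toOriginal a) := by
  induction n generalizing a with
  | zero =>
    rw [zero_add, pow_one, LinearMap.comp_apply, twistedD_apply]
    change _ = ((1 : Hˣ)⁻¹ : Hˣ).val * T.toOriginal a * (1 : Hˣ).val
    simp
  | succ n ih =>
    rw [toConv_pow_succ_apply, T.toOriginal_mul'_map (f' := LinearMap.id) (fun _ => rfl) ih,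
      mul'_map_id, lTensor_twistedD]
    rfl

theorem level_mulRev_twisted (T : Twist k H) (n : ℕ) (a : T.Twisted) : T.toOriginal
    ((WithConv.toConv (antipode k : T.Twisted →ₗ[k] T.Twisted) ^ (n + 1)).ofConv a) =
      (T.antipode ∘ₗ (level T n).mulRev ∘ₗ (level T n).twistedD) (T.toOriginal a) := by
  induction n generalizing a with
  | zero =>
    rw [zero_add, pow_one, LinearMap.comp_apply, LinearMap.comp_apply, twistedD_apply]
    change _ = T.antipode (((1 : Hˣ)⁻¹ : Hˣ).val * T.toOriginal a * (1 : Hˣ).val)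
    rw [inv_one, Units.val_one, one_mul, mul_one]
    rfl
  | succ n ih =>
    rw [toConv_pow_succ_apply, T.toOriginal_mul'_map (f' := T.antipode) (fun _ => rfl) ih,
      mul'_map_anti _ _ T.antipode_mul, lTensor_twistedD]
    rfl

end TensorPower

theorem commute_antipode {x : H} (hx : ∀ h, Commute x h)
    (hS : Function.Surjective (antipode k : H →ₗ[k] H)) (h : H) : Commute (antipode k x) h := by
  obtain ⟨g, rfl⟩ := hS h
  rw [commute_iff_eq, ← antipode_mul_antidistrib, ← antipode_mul_antidistrib, (hx g).eq]

theorem IsLeftIntegral.central {Λ : H} (hl : IsLeftIntegral k Λ) (hr : IsRightIntegral k Λ)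
    (h : H) : Commute Λ h :=
  (hr h).trans (hl h).symm

/-- All Sweedler powers of a two-sided integral are central. The twist only serves to index the
tensor powers; any will do. -/
theorem sweedlerPower_central (T : Twist k H) {Λ : H} (hl : IsLeftIntegral k Λ)
    (hr : IsRightIntegral k Λ) (hS : Function.Surjective (antipode k : H →ₗ[k] H)) (n : ℤ) (h : H) :
    Commute (sweedlerPower k n Λ) h := by
  match n with
  | Int.ofNat 0 => exact Algebra.commute_algebraMap_left _ h
  | Int.ofNat (m + 1) =>
    rw [sweedlerPower, TensorPower.level_mul T]
    cases m with
    | zero => exact hl.central hr h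
    | succ m => exact (TensorPower.level T m).consMul_succD_central hl hr hS h
  | Int.negSucc m =>
    rw [sweedlerPower, TensorPower.level_mulRev T]
    refine commute_antipode (fun g => ?_) hS h
    cases m with
    | zero => exact hl.central hr g
    | succ m => exact (TensorPower.level T m).consMulRev_succD_central hl hr g

/-- The Sweedler powers of a two-sided integral do not change under twisting. -/
theorem sweedlerPower_twisted (T : Twist k H) {Λ : H} (hl : IsLeftIntegral k Λ)
    (hr : IsRightIntegral k Λ) (hS : Function.Surjective (antipode k : H →ₗ[k] H)) (n : ℤ) :
    T.toOriginal (sweedlerPower k n (T.toOriginal.symm Λ)) = sweedlerPower k n Λ := by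
  have hP := sweedlerPower_central T hl hr hS n
  match n with
  | Int.ofNat 0 => rfl
  | Int.ofNat (m + 1) =>
    rw [sweedlerPower, TensorPower.level_mul_twisted]
    cases m with
    | zero =>
      rw [sweedlerPower, LinearMap.comp_apply, TensorPower.twistedD_apply]
      change ((1 : Hˣ)⁻¹ : Hˣ).val * Λ * (1 : Hˣ).val = _
      rw [zero_add, pow_one]
      simp
    | succ m =>
      rw [AlgEquiv.apply_symm_apply, LinearMap.comp_apply, TensorPower.twistedD_apply]
      refine ((TensorPower.level T m).consMul_twisted hl hr).trans ?_
      rw [sweedlerPower, TensorPower.level_mul T] at hP ⊢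
      rw [mul_assoc, ((TensorPower.level T m).consMul_succD_central hl hr hS _).eq, ← mul_assoc,
        T.qInv_mul_q, one_mul]
      rfl
  | Int.negSucc m =>
    obtain ⟨r, hrq⟩ := hS T.qInv
    obtain ⟨s, hs⟩ := hS T.q
    rw [sweedlerPower, TensorPower.level_mulRev_twisted]
    have key : ∀ x, T.antipode (r * x * s) = antipode k x := by
      intro x
      rw [T.antipode_apply, antipode_mul_antidistrib, antipode_mul_antidistrib, hrq, hs,
        ← mul_assoc, ← mul_assoc, T.qInv_mul_q, one_mul, mul_assoc, T.qInv_mul_q, mul_one]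
    rw [sweedlerPower, TensorPower.level_mulRev T]
    cases m with
    | zero =>
      rw [LinearMap.comp_apply, LinearMap.comp_apply, TensorPower.twistedD_apply]
      change T.antipode (((1 : Hˣ)⁻¹ : Hˣ).val * Λ * (1 : Hˣ).val) = antipode k Λ
      rw [inv_one, Units.val_one, one_mul, mul_one, T.antipode_apply, ← mul_assoc,
        ← (commute_antipode (hl.central hr) hS _).eq, mul_assoc, T.qInv_mul_q, mul_one]
    | succ m =>
      rw [AlgEquiv.apply_symm_apply, LinearMap.comp_apply, LinearMap.comp_apply,
        TensorPower.twistedD_apply]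
      refine (congrArg T.antipode
        ((TensorPower.level T m).consMulRev_twisted hl hr hrq hs)).trans ?_
      rw [key]
      rfl

end SweedlerPower

/-! ### The element `u` under twisting -/

section TwistedU

variable {k : Type*} {H : Type*} [Field k] [Ring H] [HopfAlgebra k H] (T : Twist k H)

open Coalgebra HopfAlgebra TensorProduct

namespace Twist

theorem q_mul_qInv [IsSemisimpleRing H] : T.q * T.qInv = 1 :=
  mul_eq_one_symm T.qInv_mul_q

theorem toOriginal_uElement (hq : T.q * T.qInv = 1) {Λ : H} (hl : IsLeftIntegral k Λ)
    (hr : IsRightIntegral k Λ) :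
    T.toOriginal (uElement k (T.toOriginal.symm Λ)) =
      T.qInv * HopfAlgebra.antipode k T.q * uElement k Λ := by
  have h1 : ∀ D : T.Twisted ⊗[k] T.Twisted,
      T.toOriginal (LinearMap.mul' k T.Twisted (TensorProduct.map (HopfAlgebra.antipode k)
        LinearMap.id (TensorProduct.comm k _ _ D))) =
      LinearMap.mul' k H (TensorProduct.map T.antipode LinearMap.id (TensorProduct.comm k _ _
        (TensorProduct.map T.toOriginal.toLinearMap T.toOriginal.toLinearMap D))) := by
    intro D
    induction D with
    | zero => simp
    | add x y hx hy => simp only [map_add, hx, hy]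
    | tmul a b =>
      simp only [TensorProduct.comm_tmul, TensorProduct.map_tmul, LinearMap.mul'_apply, map_mul]
      rfl
  have h2 : ∀ D : H ⊗[k] H,
      LinearMap.mul' k H (TensorProduct.map T.antipode LinearMap.id (TensorProduct.comm k _ _
        ((T.qInv ⊗ₜ[k] (1 : H)) * D * ((1 : H) ⊗ₜ[k] T.q)))) =
      T.qInv * HopfAlgebra.antipode k T.q * LinearMap.mul' k H
        (TensorProduct.map (HopfAlgebra.antipode k) LinearMap.id (TensorProduct.comm k _ _ D)) := by
    intro D
    induction D with
    | zero => simp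
    | add x y hx hy => simp only [map_add, mul_add, add_mul, hx, hy]
    | tmul a b =>
      simp only [Algebra.TensorProduct.tmul_mul_tmul, TensorProduct.comm_tmul,
        TensorProduct.map_tmul, LinearMap.mul'_apply, LinearMap.id_apply, one_mul, mul_one,
        T.antipode_apply, antipode_mul_antidistrib, mul_assoc]
      rw [← mul_assoc T.q T.qInv, hq, one_mul]
  rw [uElement, h1, T.comul_twisted, AlgEquiv.apply_symm_apply, T.inv_mul_comul hl, mul_assoc,
    T.comul_mul_J hr, ← mul_assoc, h2]
  rfl

/-- The central element `S(u) u` does not change under twisting. -/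
theorem toOriginal_antipode_uElement_mul_uElement (hq : T.q * T.qInv = 1) {Λ : H}
    (hl : IsLeftIntegral k Λ) (hr : IsRightIntegral k Λ)
    (hS : Function.Surjective (HopfAlgebra.antipode k : H →ₗ[k] H)) :
    T.toOriginal (HopfAlgebra.antipode k (uElement k (T.toOriginal.symm Λ)) *
      uElement k (T.toOriginal.symm Λ)) = HopfAlgebra.antipode k (uElement k Λ) * uElement k Λ := by
  have hq' : HopfAlgebra.antipode k T.qInv * HopfAlgebra.antipode k T.q = 1 := by
    rw [← antipode_mul_antidistrib, hq, antipode_one]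
  rw [map_mul, T.antipode_twisted, T.toOriginal_uElement hq hl hr, antipode_mul_antidistrib,
    antipode_mul_antidistrib]
  generalize hA : HopfAlgebra.antipode k (uElement k Λ) = A
  calc T.qInv * (A * (HopfAlgebra.antipode k (HopfAlgebra.antipode k T.q) *
        HopfAlgebra.antipode k T.qInv)) * T.q *
        (T.qInv * HopfAlgebra.antipode k T.q * uElement k Λ)
      = T.qInv * A * HopfAlgebra.antipode k (HopfAlgebra.antipode k T.q) *
        HopfAlgebra.antipode k T.qInv * (T.q * T.qInv) * HopfAlgebra.antipode k T.q *
        uElement k Λ := by simp only [mul_assoc]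
    _ = T.qInv * A * (HopfAlgebra.antipode k (HopfAlgebra.antipode k T.q) *
        (HopfAlgebra.antipode k T.qInv * HopfAlgebra.antipode k T.q) * uElement k Λ) := by
      rw [hq]; simp only [mul_assoc, one_mul]
    _ = T.qInv * (A * uElement k Λ * T.q) := by
      rw [hq', mul_one, ← hr.uElement_mul]; simp only [mul_assoc]
    _ = _ := by
      rw [← hA, (hr.antipode_uElement_mul_uElement_central hS _).eq, ← mul_assoc,
        T.qInv_mul_q, one_mul]

theorem isUnit_uElement_twisted (hq : T.q * T.qInv = 1) {Λ : H}
    (hl : IsLeftIntegral k Λ) (hr : IsRightIntegral k Λ) (hu : IsUnit (uElement k Λ)) :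
    IsUnit (uElement k (T.toOriginal.symm Λ)) := by
  rw [← MulEquiv.isUnit_map T.toOriginal, T.toOriginal_uElement hq hl hr]
  have h1 : IsUnit T.qInv := ⟨⟨T.qInv, T.q, T.qInv_mul_q, hq⟩, rfl⟩
  have h2 : IsUnit T.q := ⟨⟨T.q, T.qInv, hq, T.qInv_mul_q⟩, rfl⟩
  exact (h1.mul (isUnit_antipode h2)).mul hu

theorem isRightIntegral_twisted_iff {Λ : T.Twisted} :
    IsRightIntegral k Λ ↔ IsRightIntegral k (T.toOriginal Λ) := Iff.rfl

end Twist

theorem fsIndicator_twisted {V : Type*} [AddCommGroup V] [Module k V]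
    (ρ : H →ₐ[k] Module.End k V) (hq : T.q * T.qInv = 1) {Λ : H}
    (hl : IsLeftIntegral k Λ) (hr : IsRightIntegral k Λ) (hu : IsUnit (uElement k Λ)) (n : ℤ) :
    fsIndicator k (T.toOriginal.symm Λ) (T.twistRep ρ) n = fsIndicator k Λ ρ n := by
  have hS := antipode_surjective_of_isUnit hr hu
  have hP := sweedlerPower_central T hl hr hS n
  have hPJ := sweedlerPower_twisted T hl hr hS n
  have hP' : ∀ h, Commute (sweedlerPower k n (T.toOriginal.symm Λ)) h := fun h =>
    T.toOriginal.injective <| by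
      rw [map_mul, map_mul, hPJ]
      exact hP _
  have hinv : ∀ x : T.Twisted, T.toOriginal (Ring.inverse x) = Ring.inverse (T.toOriginal x) :=
    fun _ => rfl
  rw [fsIndicator_eq ρ hr hu hP, fsIndicator_eq (T.twistRep ρ)
    (Λ := T.toOriginal.symm Λ) (T.isRightIntegral_twisted_iff.2 hr)
    (T.isUnit_uElement_twisted hq hl hr hu) hP']
  have hρ : ∀ x, T.twistRep ρ x = ρ (T.toOriginal x) := fun _ => rfl
  rw [hρ, map_mul, hinv, T.toOriginal_antipode_uElement_mul_uElement hq hl hr hS, hPJ]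
  rfl

end TwistedU

end HopfFS

end

theorem mainTheorem4 {k H V : Type*} [Field k] [IsAlgClosed k] (p : ℕ) [CharP k p]
    [Ring H] [HopfAlgebra k H] [Module.Finite k H] [IsSemisimpleRing H]
    (hp : p = 0 ∨ Module.finrank k H < p ^ 2)
    [AddCommGroup V] [Module k V] [Module.Finite k V] (ρ : H →ₐ[k] Module.End k V)
    (T : HopfFS.Twist k H) :
    (∃ Λ : H, Λ ≠ 0 ∧ HopfFS.IsLeftIntegral k Λ) ∧
    (∃ Λ' : T.Twisted, Λ' ≠ 0 ∧ HopfFS.IsLeftIntegral k Λ') ∧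
    ∀ Λ : H, Λ ≠ 0 → HopfFS.IsLeftIntegral k Λ →
    ∀ Λ' : T.Twisted, Λ' ≠ 0 → HopfFS.IsLeftIntegral k Λ' →
      IsUnit (HopfFS.uElement k Λ) ∧ IsUnit (HopfFS.uElement k Λ') ∧
      ∀ n : ℤ, HopfFS.fsIndicator k Λ' (T.twistRep ρ) n = HopfFS.fsIndicator k Λ ρ n := by
  obtain ⟨Λ₀, hl, hr, h1⟩ := HopfFS.exists_isIntegral_counit_eq_one k H
  have h0 : Λ₀ ≠ 0 := by
    rintro rfl
    simp at h1
  have hu := HopfFS.isUnit_uElement p hp hl hr h1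
  have hq := T.q_mul_qInv
  have hu' := T.isUnit_uElement_twisted hq hl hr hu
  refine ⟨⟨Λ₀, h0, hl⟩, ⟨T.toOriginal.symm Λ₀, h0, hl⟩, ?_⟩
  intro Λ hΛ0 hΛ Λ' hΛ'0 hΛ'
  -- all integrals involved are nonzero multiples of `Λ₀`
  obtain ⟨c, rfl⟩ : ∃ c : k, Λ = c • Λ₀ := ⟨_, hΛ.eq_smul hr h1⟩
  obtain ⟨c', rfl⟩ : ∃ c : k, Λ' = c • T.toOriginal.symm Λ₀ :=
    ⟨_, hΛ'.eq_smul (T.isRightIntegral_twisted_iff.2 hr) h1⟩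
  have hc : c ≠ 0 := left_ne_zero_of_smul hΛ0
  have hc' : c' ≠ 0 := left_ne_zero_of_smul hΛ'0
  refine ⟨HopfFS.isUnit_uElement_smul hc hu, HopfFS.isUnit_uElement_smul hc' hu', fun n => ?_⟩
  rw [HopfFS.fsIndicator_smul hc hu, HopfFS.fsIndicator_smul hc' hu',
    HopfFS.fsIndicator_twisted T ρ hq hl hr hu]
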